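/- Let $0<s_0$ and $a\in\mathbb R$. Let $\mathscr S_a$ be the set of $s\in W^{1,\infty}(\mathbb R)$ (bounded Lipschitz functions) with $s_0\le s\le 1$ on $\mathbb R$ and $s=1$ outside $[-a,a]$. Let $\mathscr U_a$ be the set of $s\in\mathscr S_a$ that are non-increasing on $[-a,0]$ and non-decreasing on $[0,a]$, and $\mathscr A_a$ the set of $s\in\mathscr S_a$ that are even and non-decreasing on $[0,a]$. Let $\mathscr W$ be the set of locally absolutely continuous $\theta:\mathbb R\to\mathbb R$ with $\theta'\in L^2(\mathbb R)$ and $\cos\theta\in L^2(\mathbb R)$, and set $$\mathscr W_{\neq}=\Big\{\theta\in\mathscr W:\ \lim_{-\infty}\theta=-\tfrac{\pi}{2},\ \lim_{+\infty}\theta\in\tfrac{\pi}{2}+2\pi\mathbb N\Big\},\qquad W=\Big\{\theta\in\mathscr W_{\neq}:\ \overline{\theta(\mathbb R)}\subseteq[-\tfrac\pi2,\tfrac\pi2]\Big\},$$ where $0\in\mathbb N$, and, for $\theta\in\mathscr W$, $$E_s(\theta)=\frac12\int_{\mathbb R}\theta'(x)^2s(x)\,dx+\frac12\int_{\mathbb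 R}\cos^2\theta(x)\,s(x)\,dx .$$ **Proposition (Existence of a minimizer).** Let $s\in\mathscr U_a$ with $s\not\equiv1$. (i) $E_s$ has a minimizer in $\mathscr W_{\neq}$. In particular the Sturm–Liouville equation $$\theta''+\frac{s'}{s}\,\theta'+\cos\theta\,\sin\theta=0\quad\text{on }\mathbb R$$ has a solution: there is a minimizer $\theta$ of $E_s$ in $\mathscr W_{\neq}$ which is differentiable with $\theta'$ locally absolutely continuous, satisfies the equation almost everywhere, and satisfies its variational formulation $\int_{\mathbb R}\theta'\varphi's\,dx=\int_{\mathbb R}\cos\theta\,\sin\theta\,\varphi\,s\,dx$ for all $\varphi\in C_c^\infty(\mathbb R)$. (ii) For every $\theta_1\in\mathscr W_{\neq}\setminus W$ there is $\theta_0\in W$ with $E_s(\theta_0)<E_s(\theta_1)$. In particular, every minimizer of $E_s$ in $\mathscr W_{\neq}$ belongs to $W$. (iii) Every minimizer of $E_s$ in $W$ or in $\mathscr W_{\neq}$ is strictly increasing on $\mathbb R$. (iv) If $s\in\mathscr A_a$, then every minimizer of $E_s$ in $W$ or in $\mathscr W_{\neq}$ is odd. -/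

import Mathlib

open Filter Topology MeasureTheory

namespace NotchedWire

/-- The profiles `𝒮_a`: functions `s ∈ W^{1,∞}(ℝ, [s₀, 1])`, that is Lipschitz functions with values
in `[s₀, 1]`, which are equal to `1` outside `[-a, a]`. -/
structure IsNotch (s₀ a : ℝ) (s : ℝ → ℝ) : Prop where
  lipschitz : ∃ K : NNReal, LipschitzWith K s
  mem_Icc : ∀ x, s x ∈ Set.Icc s₀ 1
  eq_one : ∀ x, x ∉ Set.Icc (-a) a → s x = 1

/-- The unimodal notches `𝒰_a`. -/
structure IsUnimodalNotch (s₀ a : ℝ) (s : ℝ → ℝ) : Prop extends IsNotch s₀ a s where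
  antitoneOn : AntitoneOn s (Set.Icc (-a) 0)
  monotoneOn : MonotoneOn s (Set.Icc 0 a)

/-- The symmetric notches `𝒜_a`. -/
structure IsSymmetricNotch (s₀ a : ℝ) (s : ℝ → ℝ) : Prop extends IsNotch s₀ a s where
  even : Function.Even s
  monotoneOn : MonotoneOn s (Set.Icc 0 a)

/-- Local absolute continuity on `ℝ`, i.e. `f` is the continuous representative of an element of
`W^{1,1}_loc(ℝ)`, whose weak derivative is then the almost everywhere derivative `deriv f`. -/
def LocallyAC (f : ℝ → ℝ) : Prop :=
  ∀ a b : ℝ, AbsolutelyContinuousOnInterval f a b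

/-- The space `𝒲` of liftings `θ : ℝ → ℝ` with `θ' ∈ L²` and `cos θ ∈ L²`. -/
def liftings : Set (ℝ → ℝ) :=
  {θ | LocallyAC θ ∧ MemLp (deriv θ) 2 volume ∧ MemLp (fun x => Real.cos (θ x)) 2 volume}

/-- The space `𝒲_≠`: liftings with limit `-π/2` at `-∞` and limit in `π/2 + 2πℕ` at `+∞`. -/
def liftingsNe : Set (ℝ → ℝ) :=
  {θ | θ ∈ liftings ∧ Tendsto θ atBot (𝓝 (-(Real.pi / 2))) ∧
    ∃ k : ℕ, Tendsto θ atTop (𝓝 (Real.pi / 2 + 2 * Real.pi * k))}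

/-- The set `W` of the elements of `𝒲_≠` whose range has its closure in `[-π/2, π/2]`. -/
def liftingsW : Set (ℝ → ℝ) :=
  {θ | θ ∈ liftingsNe ∧ closure (Set.range θ) ⊆ Set.Icc (-(Real.pi / 2)) (Real.pi / 2)}

/-- The energy `E_s(θ) = ½ ∫ θ'² s + ½ ∫ cos²θ s`. -/
noncomputable def energy (s θ : ℝ → ℝ) : ℝ :=
  1 / 2 * (∫ x, deriv θ x ^ 2 * s x) + 1 / 2 * ∫ x, Real.cos (θ x) ^ 2 * s x

/-- `θ` is a minimizer of the energy `E_s` in the set `X`. -/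
def IsMinimizer (s : ℝ → ℝ) (X : Set (ℝ → ℝ)) (θ : ℝ → ℝ) : Prop :=
  θ ∈ X ∧ ∀ η ∈ X, energy s θ ≤ energy s η

/-- The variational formulation of `(s θ')' + s cos θ sin θ = 0`. -/
def IsWeakSolution (s θ : ℝ → ℝ) : Prop :=
  ∀ φ : ℝ → ℝ, ContDiff ℝ (⊤ : ℕ∞) φ → HasCompactSupport φ →
    ∫ x, deriv θ x * deriv φ x * s x = ∫ x, Real.cos (θ x) * Real.sin (θ x) * φ x * s x

/-- The Sturm–Liouville equation `θ'' + (s'/s) θ' + cos θ sin θ = 0`, for a differentiable `θ` with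
`θ'` locally absolutely continuous; `s` being only Lipschitz, it is meant almost everywhere. -/
def IsStrongSolution (s θ : ℝ → ℝ) : Prop :=
  Differentiable ℝ θ ∧ LocallyAC (deriv θ) ∧
    ∀ᵐ x : ℝ, deriv (deriv θ) x + deriv s x / s x * deriv θ x
      + Real.cos (θ x) * Real.sin (θ x) = 0

end NotchedWire

namespace NotchedWire

/-! Truncating `θ` to `[-π/2, π/2]` does not increase the energy, and lowers it strictly if `θ`
leaves that band (`energy_clamp_lt`). So minimizers in `liftingsNe` lie in `liftingsW`, and
minimizing over either set is the same problem.

Existence. Off the notch `s = 1`, and `θ' cos θ ≤ (θ'² + cos² θ)/2` bounds the tail energies below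
by `1 + sin θ(-a)` and `1 - sin θ(a)`. This leaves `coreEnergy`, a functional on the compact
interval `[-a, a]`, which the direct method minimizes (`exists_coreEnergy_minimizer`). The kink
solving `θ' = cos θ` would give exactly `2` for `s = 1`, so a genuine notch brings the minimum below
`2`. That excludes the endpoint values from which no tail can reach its limit; elsewhere, pieces of
kinks give tails attaining the lower bounds (`exists_extension`).

Monotonicity. The first variation and du Bois-Reymond give the system `s θ' = p`, `p' = -s cos θ sin
θ` (`IsMinimizer.exists_isExtremal`). The quantity `D = p² - s² cos² θ` satisfies `D' = -2 s s' cos²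
θ` and vanishes off the notch by integrability, so unimodality gives `D ≥ 0`. A zero of `p` would
force `cos θ = 0` there, and ODE uniqueness would make `θ` constant, against its limits. So `p`
never vanishes, and the limits make it positive.

Oddness. Two minimizers that meet at a point coincide: exchanging their right halves gives another
minimizer, which is differentiable, so the momenta agree too (`IsMinimizer.eq_of_eq`). For an even
notch, `-θ(-x)` is also a minimizer. If it never met `θ`, then `cos² θ(t)` and `cos² θ(-t)` would be
strictly ordered for all `t > 0`, and the vanishing of the integral of `D'` over `[-a, a]` would
force `s' = 0`, that is `s = 1`. -/

variable {s₀ a : ℝ} {s : ℝ → ℝ}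

/-! ### Locally absolutely continuous functions -/

theorem LocallyAC.continuous {f : ℝ → ℝ} (hf : LocallyAC f) : Continuous f := by
  rw [continuous_iff_continuousAt]
  intro x
  have h := (hf (x - 1) (x + 1)).continuousOn
  rw [Set.uIcc_of_le (by linarith)] at h
  exact h.continuousAt (Icc_mem_nhds (by linarith) (by linarith))

theorem LocallyAC.ae_differentiableAt {f : ℝ → ℝ} (hf : LocallyAC f) :
    ∀ᵐ x : ℝ, DifferentiableAt ℝ f x := by
  have h : ∀ n : ℕ, ∀ᵐ x : ℝ, x ∈ Set.uIcc (-(n : ℝ)) n → DifferentiableAt ℝ f x :=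
    fun n => (hf _ _).ae_differentiableAt
  filter_upwards [ae_all_iff.2 h] with x hx
  obtain ⟨n, hn⟩ := exists_nat_ge |x|
  refine hx n ?_
  rw [Set.uIcc_of_le (by linarith [abs_nonneg x])]
  exact ⟨by linarith [neg_abs_le x], by linarith [le_abs_self x]⟩

theorem LocallyAC.integral_deriv {f : ℝ → ℝ} (hf : LocallyAC f) (a b : ℝ) :
    ∫ x in a..b, deriv f x = f b - f a := (hf a b).integral_deriv_eq_sub

theorem LocallyAC.intervalIntegrable_deriv {f : ℝ → ℝ} (hf : LocallyAC f) (a b : ℝ) :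
    IntervalIntegrable (deriv f) volume a b := (hf a b).intervalIntegrable_deriv

theorem LocallyAC.add {f g : ℝ → ℝ} (hf : LocallyAC f) (hg : LocallyAC g) :
    LocallyAC (fun x => f x + g x) := fun a b => (hf a b).fun_add (hg a b)

theorem LocallyAC.mul {f g : ℝ → ℝ} (hf : LocallyAC f) (hg : LocallyAC g) :
    LocallyAC (fun x => f x * g x) := fun a b => (hf a b).fun_mul (hg a b)

theorem LocallyAC.sub {f g : ℝ → ℝ} (hf : LocallyAC f) (hg : LocallyAC g) :
    LocallyAC (fun x => f x - g x) := fun a b => (hf a b).fun_sub (hg a b)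

theorem LocallyAC.const_mul {f : ℝ → ℝ} (hf : LocallyAC f) (c : ℝ) :
    LocallyAC (fun x => c * f x) := fun a b => (hf a b).const_mul c

theorem locallyAC_of_lipschitz {f : ℝ → ℝ} {K : NNReal} (hf : LipschitzWith K f) :
    LocallyAC f := fun _ _ => hf.lipschitzOnWith.absolutelyContinuousOnInterval

theorem locallyAC_of_contDiff {f : ℝ → ℝ} (hf : ContDiff ℝ 1 f) : LocallyAC f :=
  fun _ _ => hf.contDiffOn.absolutelyContinuousOnInterval

theorem LocallyAC.lipschitz_comp {f g : ℝ → ℝ} {K : NNReal} (hg : LipschitzWith K g)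
    (hf : LocallyAC f) : LocallyAC (fun x => g (f x)) := by
  intro a b
  have h := Tendsto.const_mul (K : ℝ) (hf a b)
  rw [mul_zero] at h
  refine squeeze_zero (fun t => Finset.sum_nonneg fun i _ => dist_nonneg) (fun t => ?_) h
  rw [Finset.mul_sum]
  exact Finset.sum_le_sum fun i _ => hg.dist_le_mul _ _

theorem locallyAC_integral {g : ℝ → ℝ} (hg : LocallyIntegrable g) (C c : ℝ) :
    LocallyAC (fun x => C + ∫ t in c..x, g t) := by
  intro a b
  refine AbsolutelyContinuousOnInterval.fun_add
    (LipschitzWith.const C).lipschitzOnWith.absolutelyContinuousOnInterval ?_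
  -- The base point `c` need not lie between `a` and `b`, so integrability is taken on the hull of
  -- all three points.
  have hi : IntervalIntegrable g volume (min a (min b c)) (max a (max b c)) :=
    (hg.integrableOn_isCompact isCompact_uIcc).intervalIntegrable
  refine (hi.absolutelyContinuousOnInterval_intervalIntegral ?_).mono ?_ <;>
    grind [Set.mem_uIcc, Set.uIcc_subset_uIcc_iff_mem]

theorem deriv_integral_ae_eq {g : ℝ → ℝ} (hg : LocallyIntegrable g) (C c : ℝ) :
    deriv (fun x => C + ∫ t in c..x, g t) =ᵐ[volume] g := by
  filter_upwards [LocallyIntegrable.ae_hasDerivAt_integral hg] with x hx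
  exact ((hx c).const_add C).deriv

theorem LocallyAC.locallyIntegrable_deriv {f : ℝ → ℝ} (hf : LocallyAC f) :
    LocallyIntegrable (deriv f) := by
  intro x
  refine ⟨Set.Ioc (x - 1) (x + 1), Ioc_mem_nhds (by linarith) (by linarith), ?_⟩
  have := hf.intervalIntegrable_deriv (x - 1) (x + 1)
  rwa [intervalIntegrable_iff_integrableOn_Ioc_of_le (by linarith)] at this

theorem LocallyAC.comp_neg {f : ℝ → ℝ} (hf : LocallyAC f) : LocallyAC (fun x => f (-x)) := by
  have hi : LocallyIntegrable (fun t => -deriv f (-t)) := by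
    intro x
    refine ⟨Set.Ioc (x - 1) (x + 1), Ioc_mem_nhds (by linarith) (by linarith), ?_⟩
    have h := ((IntervalIntegrable.iff_comp_neg (by simp)).1
      (hf.intervalIntegrable_deriv (-(x - 1)) (-(x + 1)))).neg
    rw [neg_neg, neg_neg, intervalIntegrable_iff_integrableOn_Ioc_of_le (by linarith)] at h
    exact h
  have h : (fun x => f (-x)) = fun x => f 0 + ∫ t in (0 : ℝ)..x, -deriv f (-t) := by
    funext x
    rw [intervalIntegral.integral_neg, intervalIntegral.integral_comp_neg, hf.integral_deriv]
    simp
  rw [h]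
  exact locallyAC_integral hi _ _

/-! ### Gluing at a point -/

/-- The function equal to `f` on `(-∞, c]` and to `g` on `(c, ∞)`. -/
noncomputable def glue (c : ℝ) (f g : ℝ → ℝ) : ℝ → ℝ := fun x => if x ≤ c then f x else g x

theorem glue_of_le {c x : ℝ} (f g : ℝ → ℝ) (h : x ≤ c) : glue c f g x = f x := if_pos h

theorem glue_of_lt {c x : ℝ} (f g : ℝ → ℝ) (h : c < x) : glue c f g x = g x := if_neg h.not_ge

theorem glue_of_ge {c x : ℝ} {f g : ℝ → ℝ} (hc : f c = g c) (h : c ≤ x) :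
    glue c f g x = g x := by
  rcases h.eq_or_lt with rfl | h
  · rw [glue_of_le f g le_rfl, hc]
  · exact glue_of_lt f g h

theorem deriv_glue_of_lt {c x : ℝ} (f g : ℝ → ℝ) (h : x < c) :
    deriv (glue c f g) x = deriv f x := by
  refine EventuallyEq.deriv_eq ?_
  filter_upwards [Iio_mem_nhds h] with y hy
  exact glue_of_le f g (le_of_lt hy)

theorem deriv_glue_of_gt {c x : ℝ} (f g : ℝ → ℝ) (h : c < x) :
    deriv (glue c f g) x = deriv g x := by
  refine EventuallyEq.deriv_eq ?_
  filter_upwards [Ioi_mem_nhds h] with y hy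
  exact glue_of_lt f g hy

theorem deriv_glue_ae_eq (c : ℝ) (f g : ℝ → ℝ) :
    deriv (glue c f g) =ᵐ[volume] (Set.Iic c).piecewise (deriv f) (deriv g) := by
  have h : ∀ᵐ x : ℝ, x ≠ c := by simp [ae_iff, measure_singleton]
  filter_upwards [h] with x hx
  rcases lt_or_gt_of_ne hx with hx | hx
  · rw [deriv_glue_of_lt f g hx, Set.piecewise_eq_of_mem _ _ _ (Set.mem_Iic.2 hx.le)]
  · rw [deriv_glue_of_gt f g hx, Set.piecewise_eq_of_notMem _ _ _ (by simpa using hx)]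

/-- Both pieces are primitives based at `c` with the same value there, so the glued function is the
primitive of the piecewise derivative. -/
theorem LocallyAC.glue {c : ℝ} {f g : ℝ → ℝ} (hf : LocallyAC f) (hg : LocallyAC g)
    (hc : f c = g c) : LocallyAC (glue c f g) := by
  have hi : LocallyIntegrable ((Set.Iic c).piecewise (deriv f) (deriv g)) := by
    intro x
    obtain ⟨u, hu, hfu⟩ := hf.locallyIntegrable_deriv x
    obtain ⟨v, hv, hgv⟩ := hg.locallyIntegrable_deriv x
    refine ⟨u ∩ v, inter_mem hu hv, ?_⟩
    refine Integrable.piecewise measurableSet_Iic ?_ ?_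
    · exact (hfu.mono_set Set.inter_subset_left).integrable.integrableOn
    · exact (hgv.mono_set Set.inter_subset_right).integrable.integrableOn
  have h : NotchedWire.glue c f g =
      fun x => f c + ∫ t in c..x, (Set.Iic c).piecewise (deriv f) (deriv g) t := by
    funext x
    rcases le_or_gt x c with hx | hx
    · rw [glue_of_le f g hx, intervalIntegral.integral_congr_ae (g := deriv f),
        hf.integral_deriv]
      · ring
      · refine Eventually.of_forall fun t ht => ?_
        rw [Set.uIoc_of_ge hx] at ht
        exact Set.piecewise_eq_of_mem _ _ _ (Set.mem_Iic.2 ht.2)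
    · rw [glue_of_lt f g hx, intervalIntegral.integral_congr_ae (g := deriv g),
        hg.integral_deriv, hc]
      · ring
      · refine Eventually.of_forall fun t ht => ?_
        rw [Set.uIoc_of_le hx.le] at ht
        exact Set.piecewise_eq_of_notMem _ _ _ (by simpa using ht.1)
  rw [h]
  exact locallyAC_integral hi _ _

/-! ### Notches, energy density and limits of liftings -/

theorem IsNotch.continuous (hs : IsNotch s₀ a s) : Continuous s :=
  hs.lipschitz.choose_spec.continuous

theorem IsNotch.pos (hs : IsNotch s₀ a s) (hs₀ : 0 < s₀) (x : ℝ) : 0 < s x :=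
  hs₀.trans_le (hs.mem_Icc x).1

theorem IsNotch.integrable_mul (hs : IsNotch s₀ a s) (hs₀ : 0 < s₀) {f : ℝ → ℝ}
    {μ : Measure ℝ} (hf : Integrable f μ) : Integrable (fun x => f x * s x) μ := by
  refine hf.mono (hf.aestronglyMeasurable.mul hs.continuous.aestronglyMeasurable)
    (Eventually.of_forall fun x => ?_)
  rw [norm_mul]
  refine mul_le_of_le_one_right (norm_nonneg _) ?_
  rw [Real.norm_of_nonneg (hs.pos hs₀ x).le]
  exact (hs.mem_Icc x).2

theorem integrable_deriv_sq {θ : ℝ → ℝ} (hθ : θ ∈ liftings) :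
    Integrable (fun x => deriv θ x ^ 2) := hθ.2.1.integrable_sq

theorem integrable_cos_sq {θ : ℝ → ℝ} (hθ : θ ∈ liftings) :
    Integrable (fun x => Real.cos (θ x) ^ 2) := hθ.2.2.integrable_sq

/-- The energy density `½ (θ'² + cos² θ) s`. -/
noncomputable def energyDensity (s θ : ℝ → ℝ) (x : ℝ) : ℝ :=
  (deriv θ x ^ 2 + Real.cos (θ x) ^ 2) / 2 * s x

theorem IsNotch.integrable_energyDensity (hs : IsNotch s₀ a s) (hs₀ : 0 < s₀) {θ : ℝ → ℝ}
    (hθ : θ ∈ liftings) : Integrable (energyDensity s θ) :=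
  hs.integrable_mul hs₀ (((integrable_deriv_sq hθ).add (integrable_cos_sq hθ)).div_const 2)

theorem IsNotch.energy_eq_integral (hs : IsNotch s₀ a s) (hs₀ : 0 < s₀) {θ : ℝ → ℝ}
    (hθ : θ ∈ liftings) : energy s θ = ∫ x, energyDensity s θ x := by
  unfold energy energyDensity
  rw [← mul_add, ← integral_add (hs.integrable_mul hs₀ (integrable_deriv_sq hθ))
    (hs.integrable_mul hs₀ (integrable_cos_sq hθ)), ← integral_const_mul]
  congr 1
  funext x
  ring

theorem liftingsNe_continuous {θ : ℝ → ℝ} (hθ : θ ∈ liftingsNe) : Continuous θ :=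
  hθ.1.1.continuous

theorem mem_liftingsW_iff {θ : ℝ → ℝ} :
    θ ∈ liftingsW ↔ θ ∈ liftingsNe ∧ ∀ x, θ x ∈ Set.Icc (-(Real.pi / 2)) (Real.pi / 2) := by
  refine and_congr_right fun _ => ?_
  rw [isClosed_Icc.closure_subset_iff, Set.range_subset_iff]

theorem tendsto_atTop_of_mem_liftingsW {θ : ℝ → ℝ} (hθ : θ ∈ liftingsW) :
    Tendsto θ atTop (𝓝 (Real.pi / 2)) := by
  obtain ⟨hθ, hr⟩ := mem_liftingsW_iff.1 hθ
  obtain ⟨k, hk⟩ := hθ.2.2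
  have h := le_of_tendsto hk (Eventually.of_forall fun x => (hr x).2)
  have : (k : ℝ) ≤ 0 := by
    by_contra! hpos
    nlinarith [mul_pos Real.pi_pos hpos]
  have hk0 : (k : ℝ) = 0 := le_antisymm this k.cast_nonneg
  simpa [hk0] using hk

/-! ### Truncation to the band -/

/-- Truncation of `θ` to `[-π/2, π/2]`. -/
noncomputable def clamp (θ : ℝ → ℝ) (x : ℝ) : ℝ :=
  max (-(Real.pi / 2)) (min (Real.pi / 2) (θ x))

theorem clamp_mem (θ : ℝ → ℝ) (x : ℝ) :
    clamp θ x ∈ Set.Icc (-(Real.pi / 2)) (Real.pi / 2) := by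
  have := Real.pi_pos
  exact ⟨le_max_left _ _, max_le (by linarith) (min_le_left _ _)⟩

theorem clamp_of_ge {θ : ℝ → ℝ} {x : ℝ} (h : Real.pi / 2 ≤ θ x) : clamp θ x = Real.pi / 2 := by
  have := Real.pi_pos
  rw [clamp, min_eq_left h, max_eq_right (by linarith)]

theorem clamp_of_le {θ : ℝ → ℝ} {x : ℝ} (h : θ x ≤ -(Real.pi / 2)) :
    clamp θ x = -(Real.pi / 2) := by
  have := Real.pi_pos
  rw [clamp, min_eq_right (by linarith), max_eq_left h]

theorem clamp_of_mem {θ : ℝ → ℝ} {x : ℝ}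
    (h : θ x ∈ Set.Icc (-(Real.pi / 2)) (Real.pi / 2)) : clamp θ x = θ x := by
  rw [clamp, min_eq_right h.2, max_eq_right h.1]

/-- No exceptional set is needed: where `θ` is not strictly inside the band, the truncation is at a
global extremum, so its `deriv` is `0`; strictly inside, the two functions agree locally. -/
theorem deriv_clamp_sq_le (θ : ℝ → ℝ) (hθ : Continuous θ) (x : ℝ) :
    deriv (clamp θ) x ^ 2 ≤ deriv θ x ^ 2 := by
  rcases le_or_gt (Real.pi / 2) (θ x) with h | h
  · have : IsLocalMax (clamp θ) x := Eventually.of_forall fun y => by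
      rw [clamp_of_ge h]; exact (clamp_mem θ y).2
    rw [this.deriv_eq_zero]
    simpa using sq_nonneg _
  rcases le_or_gt (θ x) (-(Real.pi / 2)) with h' | h'
  · have : IsLocalMin (clamp θ) x := Eventually.of_forall fun y => by
      rw [clamp_of_le h']; exact (clamp_mem θ y).1
    rw [this.deriv_eq_zero]
    simpa using sq_nonneg _
  · have : clamp θ =ᶠ[𝓝 x] θ := by
      filter_upwards [hθ.continuousAt.preimage_mem_nhds (Ioo_mem_nhds h' h)] with y hy
      exact clamp_of_mem ⟨hy.1.le, hy.2.le⟩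
    rw [this.deriv_eq]

theorem cos_clamp_sq_le (θ : ℝ → ℝ) (x : ℝ) :
    Real.cos (clamp θ x) ^ 2 ≤ Real.cos (θ x) ^ 2 := by
  rcases le_or_gt (Real.pi / 2) (θ x) with h | h
  · rw [clamp_of_ge h, Real.cos_pi_div_two]
    simpa using sq_nonneg _
  rcases le_or_gt (θ x) (-(Real.pi / 2)) with h' | h'
  · rw [clamp_of_le h', Real.cos_neg, Real.cos_pi_div_two]
    simpa using sq_nonneg _
  · rw [clamp_of_mem ⟨h'.le, h.le⟩]

theorem lipschitzWith_truncation :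
    LipschitzWith 1 fun y : ℝ => max (-(Real.pi / 2)) (min (Real.pi / 2) y) :=
  (LipschitzWith.id.const_min _).const_max _

theorem LocallyAC.clamp {θ : ℝ → ℝ} (hθ : LocallyAC θ) : LocallyAC (clamp θ) :=
  LocallyAC.lipschitz_comp (f := θ)
    (g := fun y : ℝ => max (-(Real.pi / 2)) (min (Real.pi / 2) y)) lipschitzWith_truncation hθ

theorem tendsto_clamp {θ : ℝ → ℝ} {l : Filter ℝ} {c : ℝ} (h : Tendsto θ l (𝓝 c)) :
    Tendsto (clamp θ) l (𝓝 (max (-(Real.pi / 2)) (min (Real.pi / 2) c))) :=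
  (lipschitzWith_truncation.continuous.tendsto c).comp h

theorem clamp_mem_liftingsW {θ : ℝ → ℝ} (hθ : θ ∈ liftingsNe) : clamp θ ∈ liftingsW := by
  have hpi := Real.pi_pos
  have hac := hθ.1.1.clamp
  have h1 : MemLp (deriv (clamp θ)) 2 volume :=
    hθ.1.2.1.mono (measurable_deriv _).aestronglyMeasurable
      (Eventually.of_forall fun x => sq_le_sq.1 (deriv_clamp_sq_le θ hθ.1.1.continuous x))
  have h2 : MemLp (fun x => Real.cos (clamp θ x)) 2 volume :=
    hθ.1.2.2.mono (Real.continuous_cos.comp hac.continuous).aestronglyMeasurable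
      (Eventually.of_forall fun x => sq_le_sq.1 (cos_clamp_sq_le θ x))
  have h3 : Tendsto (clamp θ) atBot (𝓝 (-(Real.pi / 2))) := by
    have h := tendsto_clamp hθ.2.1
    rwa [min_eq_right (by linarith), max_self] at h
  have h4 : Tendsto (clamp θ) atTop (𝓝 (Real.pi / 2)) := by
    obtain ⟨k, hk⟩ := hθ.2.2
    have h := tendsto_clamp hk
    have : 0 ≤ 2 * Real.pi * k := by positivity
    rwa [min_eq_left (by linarith), max_eq_right (by linarith)] at h
  exact mem_liftingsW_iff.2 ⟨⟨⟨hac, h1, h2⟩, h3, 0, by simpa using h4⟩, clamp_mem θ⟩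

theorem energyDensity_clamp_le (hs : IsNotch s₀ a s) (hs₀ : 0 < s₀) {θ : ℝ → ℝ}
    (hθ : Continuous θ) (x : ℝ) : energyDensity s (clamp θ) x ≤ energyDensity s θ x := by
  have := deriv_clamp_sq_le θ hθ x
  have := cos_clamp_sq_le θ x
  exact mul_le_mul_of_nonneg_right (by linarith) (hs.pos hs₀ x).le

theorem energy_clamp_le (hs : IsNotch s₀ a s) (hs₀ : 0 < s₀) {θ : ℝ → ℝ}
    (hθ : θ ∈ liftingsNe) : energy s (clamp θ) ≤ energy s θ := by
  rw [hs.energy_eq_integral hs₀ hθ.1, hs.energy_eq_integral hs₀ (clamp_mem_liftingsW hθ).1.1]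
  exact integral_mono (hs.integrable_energyDensity hs₀ (clamp_mem_liftingsW hθ).1.1)
    (hs.integrable_energyDensity hs₀ hθ.1)
    (energyDensity_clamp_le hs hs₀ hθ.1.1.continuous)

/-- If `θ` leaves the band on one side, a limit at infinity on the other side of that edge lets the
intermediate value theorem produce a point just outside the band, where the cosine is nonzero while
that of the truncation is `0`. -/
theorem exists_cos_clamp_sq_lt {θ : ℝ → ℝ} (hθ : θ ∈ liftingsNe) (hW : θ ∉ liftingsW) :
    ∃ x, Real.cos (clamp θ x) ^ 2 < Real.cos (θ x) ^ 2 := by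
  have hpi := Real.pi_pos
  have hc := liftingsNe_continuous hθ
  rw [mem_liftingsW_iff] at hW
  push Not at hW
  obtain ⟨x, hx⟩ := hW hθ
  rw [Set.mem_Icc, not_and_or, not_le, not_le] at hx
  rcases hx with hx | hx
  · obtain ⟨k, hk⟩ := hθ.2.2
    have h0 : 0 ≤ 2 * Real.pi * k := by positivity
    obtain ⟨z, hz⟩ := (hk.eventually (lt_mem_nhds
      (show -(Real.pi / 2) < Real.pi / 2 + 2 * Real.pi * k by linarith))).exists
    -- The bound `-3π/2` keeps `v` in the interval where the cosine is negative, however far `θ x`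
    -- goes.
    obtain ⟨v, hv1, hv2⟩ := exists_between
      (max_lt hx (show -(3 * Real.pi / 2) < -(Real.pi / 2) by linarith))
    obtain ⟨hv0, hv1⟩ := max_lt_iff.1 hv1
    obtain ⟨y, rfl⟩ := mem_range_of_exists_le_of_exists_ge hc ⟨x, hv0.le⟩
      ⟨z, (hv2.trans hz).le⟩
    refine ⟨y, ?_⟩
    rw [clamp_of_le hv2.le, Real.cos_neg, Real.cos_pi_div_two]
    have : Real.cos (θ y) < 0 := by
      rw [← Real.cos_neg]
      exact Real.cos_neg_of_pi_div_two_lt_of_lt (by linarith) (by linarith)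
    nlinarith
  · obtain ⟨z, hz⟩ := (hθ.2.1.eventually (gt_mem_nhds
      (show -(Real.pi / 2) < Real.pi / 2 by linarith))).exists
    obtain ⟨v, hv1, hv2⟩ := exists_between
      (lt_min hx (show Real.pi / 2 < 3 * Real.pi / 2 by linarith))
    obtain ⟨hv0, hv2⟩ := lt_min_iff.1 hv2
    obtain ⟨y, rfl⟩ := mem_range_of_exists_le_of_exists_ge hc ⟨z, (hz.trans hv1).le⟩
      ⟨x, hv0.le⟩
    refine ⟨y, ?_⟩
    rw [clamp_of_ge hv1.le, Real.cos_pi_div_two]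
    have : Real.cos (θ y) < 0 :=
      Real.cos_neg_of_pi_div_two_lt_of_lt (by linarith) (by linarith)
    nlinarith

theorem energy_clamp_lt (hs : IsNotch s₀ a s) (hs₀ : 0 < s₀) {θ : ℝ → ℝ}
    (hθ : θ ∈ liftingsNe) (hW : θ ∉ liftingsW) : energy s (clamp θ) < energy s θ := by
  have hcW := clamp_mem_liftingsW hθ
  have hi := hs.integrable_energyDensity hs₀ hcW.1.1
  have hj := hs.integrable_energyDensity hs₀ hθ.1
  rw [hs.energy_eq_integral hs₀ hθ.1, hs.energy_eq_integral hs₀ hcW.1.1]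
  rw [← sub_pos, ← integral_sub hj hi]
  have hnn : ∀ x, 0 ≤ energyDensity s θ x - energyDensity s (clamp θ) x := fun x =>
    sub_nonneg.2 (energyDensity_clamp_le hs hs₀ hθ.1.1.continuous x)
  rw [integral_pos_iff_support_of_nonneg hnn (hj.sub hi)]
  obtain ⟨x, hx⟩ := exists_cos_clamp_sq_lt hθ hW
  have ho : IsOpen {x | Real.cos (clamp θ x) ^ 2 < Real.cos (θ x) ^ 2} :=
    isOpen_lt ((Real.continuous_cos.comp hcW.1.1.1.continuous).pow 2)
      ((Real.continuous_cos.comp hθ.1.1.continuous).pow 2)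
  refine (ho.measure_pos volume ⟨x, hx⟩).trans_le (measure_mono fun y hy => ?_)
  have h1 := deriv_clamp_sq_le θ hθ.1.1.continuous y
  have h2 : Real.cos (clamp θ y) ^ 2 < Real.cos (θ y) ^ 2 := hy
  have := hs.pos hs₀ y
  refine (sub_pos.2 ?_).ne'
  exact mul_lt_mul_of_pos_right (by linarith) this

theorem IsMinimizer.mem_liftingsW (hs : IsNotch s₀ a s) (hs₀ : 0 < s₀) {θ : ℝ → ℝ}
    (h : IsMinimizer s liftingsNe θ) : θ ∈ liftingsW := by
  by_contra hW
  exact (h.2 _ (clamp_mem_liftingsW h.1).1).not_gt (energy_clamp_lt hs hs₀ h.1 hW)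

theorem IsMinimizer.of_liftingsW (hs : IsNotch s₀ a s) (hs₀ : 0 < s₀) {θ : ℝ → ℝ}
    (h : IsMinimizer s liftingsW θ) : IsMinimizer s liftingsNe θ :=
  ⟨h.1.1, fun _ hη => (h.2 _ (clamp_mem_liftingsW hη)).trans (energy_clamp_le hs hs₀ hη)⟩

/-! ### First variation of the energy -/

/-- Start from `cos²(u+v) - cos² u = -sin(2u+v) sin v`. Replacing `sin v` by `v` costs at most
`2v²`, and replacing `sin(2u+v)` by `sin 2u` costs at most `v²`; hence the constant `3`, valid for
all `v`. -/
theorem cos_add_sq_le (u v : ℝ) :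
    Real.cos (u + v) ^ 2 ≤
      Real.cos u ^ 2 - 2 * v * (Real.cos u * Real.sin u) + 3 * v ^ 2 := by
  have h1 : Real.cos (u + v) ^ 2 - Real.cos u ^ 2 = -(Real.sin (2 * u + v) * Real.sin v) := by
    rw [Real.cos_add, two_mul, add_assoc, Real.sin_add, Real.sin_add, Real.cos_add]
    linear_combination (Real.cos u ^ 2) * Real.sin_sq_add_cos_sq v
  have h2 : |v - Real.sin v| ≤ 2 * v ^ 2 := by
    rcases le_or_gt |v| 1 with hv | hv
    · have hb := Real.sin_bound hv
      have h3 : |v| ^ 5 ≤ v ^ 2 := by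
        rw [← sq_abs v]; exact pow_le_pow_of_le_one (abs_nonneg v) hv (by norm_num)
      have h4 : |v ^ 3| ≤ v ^ 2 := by
        rw [abs_pow, ← sq_abs v]; exact pow_le_pow_of_le_one (abs_nonneg v) hv (by norm_num)
      rw [abs_le] at hb h4 ⊢
      constructor <;> nlinarith [sq_nonneg v]
    · have h3 : |Real.sin v| ≤ |v| := Real.abs_sin_le_abs
      calc |v - Real.sin v| ≤ |v| + |Real.sin v| := abs_sub _ _
        _ ≤ 2 * v ^ 2 := by rw [← sq_abs v]; nlinarith
  have h3 : |Real.sin (2 * u) - Real.sin (2 * u + v)| ≤ |v| := by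
    have := Real.abs_sin_sub_sin_le (2 * u) (2 * u + v)
    simpa using this
  have h4 : |Real.sin v| ≤ |v| := Real.abs_sin_le_abs
  have h5 : (v - Real.sin v) * Real.sin (2 * u) ≤ 2 * v ^ 2 := by
    refine (le_abs_self _).trans ?_
    rw [abs_mul]
    exact (mul_le_of_le_one_right (abs_nonneg _) (Real.abs_sin_le_one _)).trans h2
  have h6 : Real.sin v * (Real.sin (2 * u) - Real.sin (2 * u + v)) ≤ v ^ 2 := by
    refine (le_abs_self _).trans ?_
    rw [abs_mul, ← sq_abs v, sq]
    exact mul_le_mul h4 h3 (abs_nonneg _) (abs_nonneg _)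
  have h7 : v * Real.sin (2 * u) = 2 * v * (Real.cos u * Real.sin u) := by
    rw [Real.sin_two_mul]; ring
  nlinarith

theorem eventuallyEq_zero_of_hasCompactSupport {φ : ℝ → ℝ} (hφ : HasCompactSupport φ) :
    φ =ᶠ[atBot] 0 ∧ φ =ᶠ[atTop] 0 := by
  have h := hasCompactSupport_iff_eventuallyEq.1 hφ
  rw [coclosedCompact_eq_cocompact] at h
  exact ⟨h.filter_mono atBot_le_cocompact, h.filter_mono atTop_le_cocompact⟩

theorem deriv_add_const_mul {θ φ : ℝ → ℝ} (hθ : LocallyAC θ) (hφ : LocallyAC φ) (t : ℝ) :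
    deriv (fun x => θ x + t * φ x) =ᵐ[volume] fun x => deriv θ x + t * deriv φ x := by
  filter_upwards [hθ.ae_differentiableAt, hφ.ae_differentiableAt] with x h1 h2
  rw [deriv_fun_add h1 (h2.const_mul t), deriv_const_mul t h2]

theorem add_mem_liftingsNe {θ φ : ℝ → ℝ} (hθ : θ ∈ liftingsNe) (hφ : LocallyAC φ)
    (hc : HasCompactSupport φ) (hd : MemLp (deriv φ) 2 volume) (t : ℝ) :
    (fun x => θ x + t * φ x) ∈ liftingsNe := by
  have hac : LocallyAC (fun x => θ x + t * φ x) := hθ.1.1.add (hφ.const_mul t)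
  have hL : MemLp φ 2 volume := hφ.continuous.memLp_of_hasCompactSupport hc
  have h1 : MemLp (deriv fun x => θ x + t * φ x) 2 volume :=
    (memLp_congr_ae (deriv_add_const_mul hθ.1.1 hφ t)).2 (hθ.1.2.1.add (hd.const_mul t))
  have h2 : MemLp (fun x => Real.cos (θ x + t * φ x)) 2 volume := by
    refine (hθ.1.2.2.norm.add (hL.const_mul t).norm).mono
      (Real.continuous_cos.comp hac.continuous).aestronglyMeasurable
      (Eventually.of_forall fun x => ?_)
    have h := Real.abs_cos_sub_cos_le (θ x + t * φ x) (θ x)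
    rw [add_sub_cancel_left] at h
    have h' := abs_sub_abs_le_abs_sub (Real.cos (θ x + t * φ x)) (Real.cos (θ x))
    simp only [Real.norm_eq_abs, Pi.add_apply]
    rw [abs_of_nonneg (add_nonneg (abs_nonneg (Real.cos (θ x))) (abs_nonneg (t * φ x)))]
    linarith
  obtain ⟨hb, ht⟩ := eventuallyEq_zero_of_hasCompactSupport hc
  obtain ⟨k, hk⟩ := hθ.2.2
  refine ⟨⟨hac, h1, h2⟩, hθ.2.1.congr' ?_, k, hk.congr' ?_⟩
  · filter_upwards [hb] with x hx
    simp [hx]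
  · filter_upwards [ht] with x hx
    simp [hx]

/-- The energy increment along `θ + tφ` is at most `L t + (Q/2) t²`, and it is nonnegative for every
`t`, so the discriminant `L²` is at most `0`. Test functions are only absolutely continuous, because
du Bois-Reymond uses primitives of arbitrary `L²` functions. -/
theorem integral_eq_of_isMinimizer (hs : IsNotch s₀ a s) (hs₀ : 0 < s₀) {θ φ : ℝ → ℝ}
    (h : IsMinimizer s liftingsNe θ) (hφ : LocallyAC φ)
    (hc : HasCompactSupport φ) (hd : MemLp (deriv φ) 2 volume) :
    ∫ x, deriv θ x * deriv φ x * s x = ∫ x, Real.cos (θ x) * Real.sin (θ x) * φ x * s x := by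
  have hθ := h.1
  have hL : MemLp φ 2 volume := hφ.continuous.memLp_of_hasCompactSupport hc
  have i1 : Integrable fun x => deriv θ x * deriv φ x * s x :=
    hs.integrable_mul hs₀ (hθ.1.2.1.integrable_mul hd)
  have i2 : Integrable fun x => Real.cos (θ x) * Real.sin (θ x) * φ x * s x := by
    refine hs.integrable_mul hs₀ (Continuous.integrable_of_hasCompactSupport ?_ hc.mul_left)
    have := hθ.1.1.continuous
    have := hφ.continuous
    fun_prop
  have i3 : Integrable fun x => (deriv φ x ^ 2 + 3 * φ x ^ 2) * s x :=
    hs.integrable_mul hs₀ (hd.integrable_sq.add (hL.integrable_sq.const_mul 3))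
  rw [← sub_eq_zero, ← integral_sub i1 i2]
  set Q := ∫ x, (deriv φ x ^ 2 + 3 * φ x ^ 2) * s x
  set L := ∫ x, deriv θ x * deriv φ x * s x - Real.cos (θ x) * Real.sin (θ x) * φ x * s x
  have key : ∀ t : ℝ, 0 ≤ (Q / 2) * (t * t) + L * t + 0 := by
    intro t
    have hm := add_mem_liftingsNe hθ hφ hc hd t
    have hmin := h.2 _ hm
    rw [hs.energy_eq_integral hs₀ hθ.1, hs.energy_eq_integral hs₀ hm.1] at hmin
    have j1 := hs.integrable_energyDensity hs₀ hθ.1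
    have j2 : Integrable fun x => t * (deriv θ x * deriv φ x * s x -
        Real.cos (θ x) * Real.sin (θ x) * φ x * s x) := (i1.sub i2).const_mul t
    have j12 : Integrable fun x => energyDensity s θ x + t * (deriv θ x * deriv φ x * s x -
        Real.cos (θ x) * Real.sin (θ x) * φ x * s x) := j1.add j2
    have j3 := i3.const_mul (t ^ 2 / 2)
    have hle : ∫ x, energyDensity s (fun x => θ x + t * φ x) x ≤
        ∫ x, (energyDensity s θ x + t * (deriv θ x * deriv φ x * s x -
          Real.cos (θ x) * Real.sin (θ x) * φ x * s x)) +
          t ^ 2 / 2 * ((deriv φ x ^ 2 + 3 * φ x ^ 2) * s x) := by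
      refine integral_mono_ae (hs.integrable_energyDensity hs₀ hm.1) (j12.add j3) ?_
      filter_upwards [deriv_add_const_mul hθ.1.1 hφ t] with x hx
      have h1 := cos_add_sq_le (θ x) (t * φ x)
      have h2 := (hs.pos hs₀ x).le
      simp only [energyDensity, hx]
      have := mul_le_mul_of_nonneg_right h1 h2
      nlinarith
    rw [integral_add j12 j3, integral_add j1 j2, integral_const_mul,
      integral_const_mul] at hle
    nlinarith
  have hdisc := discrim_le_zero key
  rw [discrim] at hdisc
  nlinarith [sq_nonneg L]

theorem IsMinimizer.isWeakSolution (hs : IsNotch s₀ a s) (hs₀ : 0 < s₀) {θ : ℝ → ℝ}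
    (h : IsMinimizer s liftingsNe θ) : IsWeakSolution s θ := by
  intro φ hφ hc
  refine integral_eq_of_isMinimizer hs hs₀ h (locallyAC_of_contDiff (hφ.of_le (by simp))) hc ?_
  exact (hφ.continuous_deriv (by simp)).memLp_of_hasCompactSupport hc.deriv

/-! ### The first-order system -/

/-- The du Bois-Reymond lemma on `(-R, R]`. -/
theorem ae_eq_const_of_integral_mul_eq_zero {h : ℝ → ℝ} {R : ℝ} (hR : 0 < R)
    (hh : MemLp h 2 (volume.restrict (Set.Ioc (-R) R)))
    (H : ∀ g : ℝ → ℝ, MemLp g 2 (volume.restrict (Set.Ioc (-R) R)) →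
      ∫ x in Set.Ioc (-R) R, g x = 0 → ∫ x in Set.Ioc (-R) R, h x * g x = 0) :
    ∃ m : ℝ, ∀ᵐ x ∂volume.restrict (Set.Ioc (-R) R), h x = m := by
  set μ := volume.restrict (Set.Ioc (-R) R)
  have hi : Integrable h μ := hh.integrable (by norm_num)
  -- The mean of `h`: then `h - m` is an admissible test function, and testing with it gives `∫ (h -
  -- m)² = 0`.
  set m := (∫ x, h x ∂μ) / (2 * R) with hm
  have hgm : MemLp (fun x => h x - m) 2 μ := hh.sub (memLp_const m)
  have hμ : μ.real Set.univ = 2 * R := by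
    simp only [μ, measureReal_def, Measure.restrict_apply_univ, Real.volume_Ioc]
    rw [ENNReal.toReal_ofReal (by linarith)]
    ring
  have h0 : ∫ x, h x - m ∂μ = 0 := by
    rw [integral_sub hi (integrable_const m), integral_const, hμ, hm, smul_eq_mul]
    field_simp
    ring
  have h1 := H _ hgm h0
  have h2 : ∫ x, (h x - m) ^ 2 ∂μ = 0 := by
    have : ∀ x, (h x - m) ^ 2 = h x * (h x - m) - m * (h x - m) := fun x => by ring
    simp_rw [this]
    have j : Integrable (fun x => h x * (h x - m)) μ := hh.integrable_mul hgm
    rw [integral_sub j ((hgm.integrable (by norm_num)).const_mul m), h1,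
      integral_const_mul, h0]
    simp
  refine ⟨m, ?_⟩
  rw [integral_eq_zero_iff_of_nonneg (fun x => sq_nonneg _) hgm.integrable_sq] at h2
  filter_upwards [h2] with x hx
  have : h x - m = 0 := by simpa using hx
  linarith

/-- The first order system `s θ' = p`, `p' = -s cos θ sin θ`. -/
structure IsExtremal (s θ p : ℝ → ℝ) : Prop where
  hasDerivAt : ∀ x, HasDerivAt θ (p x / s x) x
  hasDerivAt_momentum : ∀ x, HasDerivAt p (-(Real.cos (θ x) * Real.sin (θ x) * s x)) x

/-- Integrating the potential term by parts against `P` turns the first variation into orthogonality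
of `s θ' - P` to every mean-zero `g` on `(-R, R]`. -/
theorem exists_momentum_eq_add_const (hs : IsNotch s₀ a s) (hs₀ : 0 < s₀) {θ P : ℝ → ℝ}
    (h : IsMinimizer s liftingsNe θ) (hP : LocallyAC P)
    (hP' : ∀ x, deriv P x = -(Real.cos (θ x) * Real.sin (θ x) * s x)) {R : ℝ} (hR : 0 < R) :
    ∃ m : ℝ, ∀ᵐ x ∂volume.restrict (Set.Ioc (-R) R), deriv θ x * s x - P x = m := by
  have hθ := h.1
  have hq : MemLp (fun x => deriv θ x * s x) 2 (volume.restrict (Set.Ioc (-R) R)) := by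
    refine (hθ.1.2.1.restrict _).mono
      ((measurable_deriv θ).mul hs.continuous.measurable).aestronglyMeasurable
      (Eventually.of_forall fun x => ?_)
    rw [norm_mul]
    refine mul_le_of_le_one_right (norm_nonneg _) ?_
    rw [Real.norm_of_nonneg (hs.pos hs₀ x).le]
    exact (hs.mem_Icc x).2
  have hPL : MemLp P 2 (volume.restrict (Set.Ioc (-R) R)) := by
    obtain ⟨C, hC⟩ := (isCompact_Icc (a := -R) (b := R)).exists_bound_of_continuousOn
      hP.continuous.continuousOn
    refine MemLp.of_bound hP.continuous.aestronglyMeasurable C ?_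
    filter_upwards [ae_restrict_mem measurableSet_Ioc] with x hx
    exact hC x (Set.Ioc_subset_Icc_self hx)
  refine ae_eq_const_of_integral_mul_eq_zero hR (hq.sub hPL) fun g hg hg0 => ?_
  set G := (Set.Ioc (-R) R).indicator g with hG
  have hgi : IntegrableOn g (Set.Ioc (-R) R) := hg.integrable (by norm_num)
  have hGi : Integrable G := hgi.integrable_indicator measurableSet_Ioc
  -- The primitive of the cut-off `g`; the zero mean of `g` is what makes it vanish to the right of
  -- `R`.
  set φ : ℝ → ℝ := fun x => 0 + ∫ t in (-R)..x, G t with hφdef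
  have hφ : LocallyAC φ := locallyAC_integral hGi.locallyIntegrable _ _
  have hφd : deriv φ =ᵐ[volume] G := deriv_integral_ae_eq hGi.locallyIntegrable _ _
  have hGeq : ∀ u : ℝ → ℝ, ∫ t in (-R)..R, G t * u t = ∫ t in Set.Ioc (-R) R, g t * u t := by
    intro u
    rw [intervalIntegral.integral_of_le (by linarith)]
    refine setIntegral_congr_fun measurableSet_Ioc fun x hx => ?_
    simp only [hG, Set.indicator_of_mem hx]
  have hφR : φ R = 0 := by
    have := hGeq 1
    simp only [Pi.one_apply, mul_one] at this
    simp only [hφdef, this, hg0, add_zero]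
  have hφ0 : ∀ x, x ∉ Set.Ioc (-R) R → φ x = 0 := by
    intro x hx
    rw [Set.mem_Ioc, not_and_or, not_lt, not_le] at hx
    rcases hx with hx | hx
    · have : ∫ t in (-R)..x, G t = ∫ t in (-R)..x, (0 : ℝ) := by
        refine intervalIntegral.integral_congr_ae (Eventually.of_forall fun t ht => ?_)
        rw [Set.uIoc_of_ge hx] at ht
        exact Set.indicator_of_notMem (fun h' => by linarith [ht.2, h'.1]) _
      simp [hφdef, this]
    · have h1 : ∫ t in R..x, G t = ∫ t in R..x, (0 : ℝ) := by
        refine intervalIntegral.integral_congr_ae (Eventually.of_forall fun t ht => ?_)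
        rw [Set.uIoc_of_le hx.le] at ht
        exact Set.indicator_of_notMem (fun h' => by linarith [ht.1, h'.2]) _
      have h2 := intervalIntegral.integral_add_adjacent_intervals
        (hGi.intervalIntegrable (a := -R) (b := R)) (hGi.intervalIntegrable (a := R) (b := x))
      have h3 : φ x = φ R + ∫ t in R..x, G t := by simp only [hφdef, ← h2]; ring
      rw [h3, hφR, h1]
      simp
  have hc : HasCompactSupport φ := HasCompactSupport.intro (isCompact_Icc (a := -R) (b := R))
    fun x hx => hφ0 x fun h' => hx (Set.Ioc_subset_Icc_self h')
  have hd : MemLp (deriv φ) 2 volume :=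
    (memLp_congr_ae hφd).2 ((memLp_indicator_iff_restrict measurableSet_Ioc).2 hg)
  have hEL := integral_eq_of_isMinimizer hs hs₀ h hφ hc hd
  have hl : ∫ x, deriv θ x * deriv φ x * s x =
      ∫ x in Set.Ioc (-R) R, deriv θ x * s x * g x := by
    rw [← integral_indicator measurableSet_Ioc]
    refine integral_congr_ae ?_
    filter_upwards [hφd] with x hx
    rw [hx, hG]
    by_cases hxm : x ∈ Set.Ioc (-R) R
    · rw [Set.indicator_of_mem hxm, Set.indicator_of_mem hxm]; ring
    · rw [Set.indicator_of_notMem hxm, Set.indicator_of_notMem hxm]; ring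
  have hr : ∫ x, Real.cos (θ x) * Real.sin (θ x) * φ x * s x =
      ∫ x in Set.Ioc (-R) R, P x * g x := by
    rw [← setIntegral_eq_integral_of_forall_compl_eq_zero (s := Set.Ioc (-R) R)
      (fun x hx => by rw [hφ0 x hx]; ring),
      ← intervalIntegral.integral_of_le (by linarith)]
    have h1 := (hφ (-R) R).integral_mul_deriv_eq_deriv_mul (hP (-R) R)
    rw [hφR, hφ0 (-R) (fun h' => lt_irrefl _ h'.1)] at h1
    have h2 : ∫ x in (-R)..R, deriv φ x * P x = ∫ x in (-R)..R, G x * P x :=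
      intervalIntegral.integral_congr_ae (by
        filter_upwards [hφd] with x hx _
        rw [hx])
    rw [h2, hGeq] at h1
    have h3 : ∫ x in (-R)..R, Real.cos (θ x) * Real.sin (θ x) * φ x * s x =
        - ∫ x in (-R)..R, φ x * deriv P x := by
      rw [← intervalIntegral.integral_neg]
      congr 1
      funext x
      rw [hP']
      ring
    rw [h3, h1]
    simp only [mul_comm (g _)]
    ring
  have e : ∀ x, (deriv θ x * s x - P x) * g x = deriv θ x * s x * g x - P x * g x :=
    fun x => by ring
  have i1 : Integrable (fun x => deriv θ x * s x * g x) (volume.restrict (Set.Ioc (-R) R)) :=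
    hq.integrable_mul hg
  have i2 : Integrable (fun x => P x * g x) (volume.restrict (Set.Ioc (-R) R)) :=
    hPL.integrable_mul hg
  show ∫ x in Set.Ioc (-R) R, (deriv θ x * s x - P x) * g x = 0
  simp_rw [e]
  rw [integral_sub i1 i2, ← hl, ← hr, hEL, sub_self]

/-- The constants on the nested intervals agree, so almost everywhere `θ'` equals the continuous
function `(P + m)/s`. Since `θ` is the integral of its derivative, equality holds everywhere. -/
theorem IsMinimizer.exists_isExtremal (hs : IsNotch s₀ a s) (hs₀ : 0 < s₀) {θ : ℝ → ℝ}
    (h : IsMinimizer s liftingsNe θ) : ∃ p, IsExtremal s θ p := by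
  have hθc := h.1.1.1.continuous
  have hsc := hs.continuous
  set f : ℝ → ℝ := fun x => -(Real.cos (θ x) * Real.sin (θ x) * s x) with hf
  have hfc : Continuous f := by fun_prop
  set P : ℝ → ℝ := fun x => ∫ t in (0 : ℝ)..x, f t with hPdef
  have hPd : ∀ x, HasDerivAt P (f x) x := fun x => (hfc.integral_hasStrictDerivAt 0 x).hasDerivAt
  have hPac : LocallyAC P := by
    simpa using locallyAC_integral hfc.locallyIntegrable 0 0
  choose! m hm using fun (R : ℝ) (hR : 0 < R) =>
    exists_momentum_eq_add_const hs hs₀ h hPac (fun x => (hPd x).deriv) hR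
  have hmm : ∀ R, 1 ≤ R → m R = m 1 := by
    intro R hR
    have h1 := hm R (by linarith)
    have h2 := hm 1 one_pos
    have h3 := ae_restrict_of_ae_restrict_of_subset
      (Set.Ioc_subset_Ioc (neg_le_neg hR) hR) h1
    have : (ae (volume.restrict (Set.Ioc (-1 : ℝ) 1))).NeBot := by
      rw [ae_neBot, Ne, Measure.restrict_eq_zero, Real.volume_Ioc]
      norm_num
    obtain ⟨x, hx, hx'⟩ := (h3.and h2).exists
    exact hx.symm.trans hx'
  have hae : ∀ᵐ x : ℝ, deriv θ x * s x - P x = m 1 := by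
    have h1 : ∀ n : ℕ, ∀ᵐ x : ℝ, x ∈ Set.Ioc (-((n : ℝ) + 1)) (n + 1) →
        deriv θ x * s x - P x = m 1 := by
      intro n
      have := hm (n + 1) (by positivity)
      rw [hmm _ (by simp)] at this
      exact (ae_restrict_iff' measurableSet_Ioc).1 this
    filter_upwards [ae_all_iff.2 h1] with x hx
    obtain ⟨n, hn⟩ := exists_nat_ge |x|
    exact hx n ⟨by linarith [neg_abs_le x], by linarith [le_abs_self x]⟩
  refine ⟨fun x => P x + m 1, fun x => ?_, fun x => (hPd x).add_const _⟩
  have hPc : Continuous P := hPac.continuous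
  have hgc : Continuous fun x => (P x + m 1) / s x :=
    (hPc.add continuous_const).div hsc fun x => (hs.pos hs₀ x).ne'
  have heq : θ = fun x => θ 0 + ∫ t in (0 : ℝ)..x, (P t + m 1) / s t := by
    funext x
    rw [intervalIntegral.integral_congr_ae (g := deriv θ), h.1.1.1.integral_deriv]
    · ring
    · filter_upwards [hae] with t ht _
      rw [div_eq_iff (hs.pos hs₀ t).ne']
      linarith
  rw [heq]
  exact (hgc.integral_hasStrictDerivAt 0 x).hasDerivAt.const_add _

/-! ### Regularity and uniqueness of extremals -/

theorem IsExtremal.deriv_eq {θ p : ℝ → ℝ} (h : IsExtremal s θ p) :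
    deriv θ = fun x => p x / s x := funext fun x => (h.hasDerivAt x).deriv

theorem IsExtremal.continuous {θ p : ℝ → ℝ} (h : IsExtremal s θ p) : Continuous θ :=
  continuous_iff_continuousAt.2 fun x => (h.hasDerivAt x).continuousAt

theorem IsExtremal.continuous_momentum {θ p : ℝ → ℝ} (h : IsExtremal s θ p) : Continuous p :=
  continuous_iff_continuousAt.2 fun x => (h.hasDerivAt_momentum x).continuousAt

theorem IsExtremal.locallyAC_momentum (hs : IsNotch s₀ a s) {θ p : ℝ → ℝ}
    (h : IsExtremal s θ p) : LocallyAC p := by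
  refine locallyAC_of_contDiff (contDiff_one_iff_deriv.2
    ⟨fun x => (h.hasDerivAt_momentum x).differentiableAt, ?_⟩)
  have hc := h.continuous
  have hsc := hs.continuous
  rw [show deriv p = _ from funext fun x => (h.hasDerivAt_momentum x).deriv]
  fun_prop

theorem IsNotch.locallyAC (hs : IsNotch s₀ a s) : LocallyAC s :=
  locallyAC_of_lipschitz hs.lipschitz.choose_spec

theorem IsNotch.locallyAC_inv (hs : IsNotch s₀ a s) (hs₀ : 0 < s₀) :
    LocallyAC fun x => (s x)⁻¹ := by
  obtain ⟨K, hK⟩ := hs.lipschitz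
  refine locallyAC_of_lipschitz (K := K * (Real.toNNReal (s₀⁻¹ * s₀⁻¹)))
    (LipschitzWith.of_dist_le_mul fun x y => ?_)
  have hx := hs.pos hs₀ x
  have hy := hs.pos hs₀ y
  have h1 := hK.dist_le_mul x y
  rw [NNReal.coe_mul, Real.coe_toNNReal _ (by positivity), Real.dist_eq,
    inv_sub_inv hx.ne' hy.ne', abs_div, abs_of_pos (mul_pos hx hy), div_eq_mul_inv, mul_inv,
    mul_right_comm, abs_sub_comm, ← Real.dist_eq]
  have h2 : (s x)⁻¹ ≤ s₀⁻¹ := inv_anti₀ hs₀ (hs.mem_Icc x).1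
  have h3 : (s y)⁻¹ ≤ s₀⁻¹ := inv_anti₀ hs₀ (hs.mem_Icc y).1
  gcongr

theorem IsExtremal.isStrongSolution (hs : IsNotch s₀ a s) (hs₀ : 0 < s₀) {θ p : ℝ → ℝ}
    (h : IsExtremal s θ p) : IsStrongSolution s θ := by
  refine ⟨fun x => (h.hasDerivAt x).differentiableAt, ?_, ?_⟩
  · rw [h.deriv_eq]
    exact (h.locallyAC_momentum hs).mul (hs.locallyAC_inv hs₀)
  · filter_upwards [hs.locallyAC.ae_differentiableAt] with x hx
    have hpos := (hs.pos hs₀ x).ne'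
    rw [h.deriv_eq, ((h.hasDerivAt_momentum x).fun_div hx.hasDerivAt hpos).deriv]
    field_simp
    ring

theorem abs_cos_mul_sin_sub_le (u v : ℝ) :
    |Real.cos u * Real.sin u - Real.cos v * Real.sin v| ≤ |u - v| := by
  have h := Real.abs_sin_sub_sin_le (2 * u) (2 * v)
  rw [Real.sin_two_mul, Real.sin_two_mul, ← mul_sub, abs_mul, abs_two] at h
  have e : 2 * Real.sin u * Real.cos u - 2 * Real.sin v * Real.cos v =
    2 * (Real.cos u * Real.sin u - Real.cos v * Real.sin v) := by ring
  rw [e, abs_mul, abs_two] at h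
  linarith

theorem IsExtremal.unique (hs : IsNotch s₀ a s) (hs₀ : 0 < s₀) {θ p η q : ℝ → ℝ}
    (h : IsExtremal s θ p) (h' : IsExtremal s η q) {x₀ : ℝ} (h1 : θ x₀ = η x₀)
    (h2 : p x₀ = q x₀) : θ = η := by
  -- In the sup norm on pairs, the first component of the field has Lipschitz constant `1/s ≤ 1/s₀`
  -- and the second `s ≤ 1`, uniformly in time.
  have key := ODE_solution_unique_univ (E := ℝ × ℝ)
    (v := fun t z => (z.2 / s t, -(Real.cos z.1 * Real.sin z.1 * s t))) (s := fun _ => Set.univ)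
    (K := Real.toNNReal (max s₀⁻¹ 1)) (f := fun t => (θ t, p t)) (g := fun t => (η t, q t))
    (t₀ := x₀) ?_ (fun t => ⟨(h.hasDerivAt t).prodMk (h.hasDerivAt_momentum t), trivial⟩)
    (fun t => ⟨(h'.hasDerivAt t).prodMk (h'.hasDerivAt_momentum t), trivial⟩)
    (Prod.ext h1 h2)
  · funext x
    exact congrArg Prod.fst (congrFun key x)
  · intro t
    refine (LipschitzWith.of_dist_le_mul fun z w => ?_).lipschitzOnWith
    have hst := hs.pos hs₀ t
    rw [Real.coe_toNNReal _ (by positivity), Prod.dist_eq]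
    refine max_le ?_ ?_
    · rw [Real.dist_eq, ← sub_div, abs_div, abs_of_pos hst, div_eq_inv_mul]
      refine mul_le_mul ?_ ?_ (abs_nonneg _) (by positivity)
      · exact (inv_anti₀ hs₀ (hs.mem_Icc t).1).trans (le_max_left _ _)
      · rw [← Real.dist_eq, Prod.dist_eq]
        exact le_max_right _ _
    · have h3 := abs_cos_mul_sin_sub_le z.1 w.1
      rw [Real.dist_eq, neg_sub_neg, ← sub_mul, abs_mul, abs_of_pos hst, abs_sub_comm, mul_comm]
      refine mul_le_mul ?_ ?_ (abs_nonneg _) (by positivity)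
      · exact (hs.mem_Icc t).2.trans (le_max_right _ _)
      · rw [Prod.dist_eq]
        exact h3.trans ((Real.dist_eq _ _).symm.le.trans (le_max_left _ _))

theorem IsExtremal.locallyAC (hs : IsNotch s₀ a s) (hs₀ : 0 < s₀) {θ p : ℝ → ℝ}
    (h : IsExtremal s θ p) : LocallyAC θ := by
  refine locallyAC_of_contDiff (contDiff_one_iff_deriv.2
    ⟨fun x => (h.hasDerivAt x).differentiableAt, ?_⟩)
  rw [h.deriv_eq]
  exact h.continuous_momentum.div hs.continuous fun x => (hs.pos hs₀ x).ne'

/-! ### The defect and strict monotonicity -/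

/-- The first integral `s² (θ'² - cos² θ)` of the equation where `s` is constant. -/
noncomputable def defect (s θ p : ℝ → ℝ) (x : ℝ) : ℝ :=
  p x * p x - s x * Real.cos (θ x) * (s x * Real.cos (θ x))

theorem IsExtremal.locallyAC_defect (hs : IsNotch s₀ a s) (hs₀ : 0 < s₀) {θ p : ℝ → ℝ}
    (h : IsExtremal s θ p) : LocallyAC (defect s θ p) := by
  have hp := h.locallyAC_momentum hs
  have hcos : LipschitzWith 1 Real.cos := LipschitzWith.of_dist_le_mul fun x y => by
    simpa [Real.dist_eq] using Real.abs_cos_sub_cos_le x y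
  have hc := hs.locallyAC.mul (LocallyAC.lipschitz_comp (f := θ) hcos (h.locallyAC hs hs₀))
  exact (hp.mul hp).sub (hc.mul hc)

/-- The two terms in `p s cos θ sin θ` cancel, so only the variation of `s` contributes. -/
theorem IsExtremal.deriv_defect (hs : IsNotch s₀ a s) (hs₀ : 0 < s₀) {θ p : ℝ → ℝ}
    (h : IsExtremal s θ p) :
    ∀ᵐ x : ℝ, deriv (defect s θ p) x = -2 * (deriv s x * (s x * Real.cos (θ x) ^ 2)) := by
  filter_upwards [hs.locallyAC.ae_differentiableAt] with x hx
  have hpos := (hs.pos hs₀ x).ne'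
  have h1 := h.hasDerivAt_momentum x
  have h2 := hx.hasDerivAt.mul (h.hasDerivAt x).cos
  have h3 := ((h1.mul h1).sub (h2.mul h2)).deriv
  refine h3.trans ?_
  simp only [Pi.mul_apply]
  field_simp
  ring

theorem IsExtremal.integrable_defect (hs : IsNotch s₀ a s) (hs₀ : 0 < s₀) {θ p : ℝ → ℝ}
    (hθ : θ ∈ liftings) (h : IsExtremal s θ p) : Integrable (defect s θ p) := by
  have h1 := hs.integrable_mul hs₀ (hs.integrable_mul hs₀
    ((integrable_deriv_sq hθ).sub (integrable_cos_sq hθ)))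
  refine h1.congr (Eventually.of_forall fun x => ?_)
  have hpos := (hs.pos hs₀ x).ne'
  simp only [defect, Pi.sub_apply, h.deriv_eq]
  field_simp

theorem IsExtremal.integral_deriv_mul (hs : IsNotch s₀ a s) (hs₀ : 0 < s₀) {θ p : ℝ → ℝ}
    (h : IsExtremal s θ p) (x y : ℝ) :
    -2 * ∫ t in x..y, deriv s t * (s t * Real.cos (θ t) ^ 2) =
      defect s θ p y - defect s θ p x := by
  rw [← (h.locallyAC_defect hs hs₀).integral_deriv, ← intervalIntegral.integral_const_mul]
  refine intervalIntegral.integral_congr_ae ?_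
  filter_upwards [h.deriv_defect hs hs₀] with t ht _
  exact ht.symm

theorem IsNotch.deriv_eq_zero (hs : IsNotch s₀ a s) {x : ℝ} (hx : x ∉ Set.Icc (-a) a) :
    deriv s x = 0 := by
  have : s =ᶠ[𝓝 x] fun _ => 1 := by
    filter_upwards [isClosed_Icc.isOpen_compl.mem_nhds hx] with y hy
    exact hs.eq_one y hy
  rw [this.deriv_eq]
  simp

/-- Past the notch `s' = 0`, so the defect is constant on a half-line; being integrable there, it is
`0`. -/
theorem IsExtremal.defect_eq_zero_of_ge (hs : IsNotch s₀ a s) (hs₀ : 0 < s₀) {θ p : ℝ → ℝ}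
    (hθ : θ ∈ liftings) (h : IsExtremal s θ p) {x : ℝ} (hx : a ≤ x) : defect s θ p x = 0 := by
  have hc : ∀ y ∈ Set.Ioi x, defect s θ p y = defect s θ p x := by
    intro y hy
    have h1 := h.integral_deriv_mul hs hs₀ x y
    have h2 : ∫ t in x..y, deriv s t * (s t * Real.cos (θ t) ^ 2) = ∫ t in x..y, (0 : ℝ) := by
      refine intervalIntegral.integral_congr_ae (Eventually.of_forall fun t ht => ?_)
      rw [Set.uIoc_of_le (le_of_lt hy)] at ht
      rw [hs.deriv_eq_zero fun h' => by linarith [ht.1, h'.2], zero_mul]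
    rw [h2] at h1
    simp only [intervalIntegral.integral_zero] at h1
    linarith
  have hi := (integrableOn_congr_fun hc measurableSet_Ioi).1
    (h.integrable_defect hs hs₀ hθ).integrableOn
  rw [integrableOn_const_iff] at hi
  simpa using hi

theorem IsExtremal.defect_eq_zero_of_le (hs : IsNotch s₀ a s) (hs₀ : 0 < s₀) {θ p : ℝ → ℝ}
    (hθ : θ ∈ liftings) (h : IsExtremal s θ p) {x : ℝ} (hx : x ≤ -a) : defect s θ p x = 0 := by
  have hc : ∀ y ∈ Set.Iio x, defect s θ p y = defect s θ p x := by
    intro y hy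
    have h1 := h.integral_deriv_mul hs hs₀ y x
    have h2 : ∫ t in y..x, deriv s t * (s t * Real.cos (θ t) ^ 2) = ∫ t in y..x, (0 : ℝ) := by
      -- The interval contains `x`, which may be the notch edge `-a`, where `deriv s` need not
      -- vanish.
      have hne : ∀ᵐ t : ℝ, t ≠ x := by simp [ae_iff, measure_singleton]
      refine intervalIntegral.integral_congr_ae ?_
      filter_upwards [hne] with t hne ht
      rw [Set.uIoc_of_le (le_of_lt hy)] at ht
      rw [hs.deriv_eq_zero fun h' => hne (le_antisymm ht.2 (by linarith [h'.1])), zero_mul]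
    rw [h2] at h1
    simp only [intervalIntegral.integral_zero] at h1
    linarith
  have hi := (integrableOn_congr_fun hc measurableSet_Iio).1
    (h.integrable_defect hs hs₀ hθ).integrableOn
  rw [integrableOn_const_iff] at hi
  simpa using hi

theorem deriv_nonneg_of_monotoneOn {x u v : ℝ} {f : ℝ → ℝ} (hf : MonotoneOn f (Set.Icc u v))
    (hx : x ∈ Set.Ioo u v) : 0 ≤ deriv f x := by
  rw [← derivWithin_of_mem_nhds (Icc_mem_nhds hx.1 hx.2)]
  exact hf.derivWithin_nonneg

/-- The defect vanishes at `-a` and at `a`; its derivative has the sign of `-s'`, so it rises from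
`0` on `[-a, 0]` and falls back to `0` on `[0, a]`. -/
theorem IsExtremal.defect_nonneg (hs : IsUnimodalNotch s₀ a s) (hs₀ : 0 < s₀) {θ p : ℝ → ℝ}
    (hθ : θ ∈ liftings) (h : IsExtremal s θ p) (x : ℝ) : 0 ≤ defect s θ p x := by
  have hn := hs.toIsNotch
  have hw : ∀ t, 0 ≤ s t * Real.cos (θ t) ^ 2 := fun t =>
    mul_nonneg (hn.pos hs₀ t).le (sq_nonneg _)
  rcases le_or_gt a x with hax | hax
  · rw [h.defect_eq_zero_of_ge hn hs₀ hθ hax]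
  rcases le_or_gt x (-a) with hxa | hxa
  · rw [h.defect_eq_zero_of_le hn hs₀ hθ hxa]
  rcases le_or_gt 0 x with hx | hx
  · have h1 := h.integral_deriv_mul hn hs₀ x a
    rw [h.defect_eq_zero_of_ge hn hs₀ hθ le_rfl] at h1
    have h2 : 0 ≤ ∫ t in x..a, deriv s t * (s t * Real.cos (θ t) ^ 2) := by
      rw [intervalIntegral.integral_of_le hax.le, integral_Ioc_eq_integral_Ioo]
      refine setIntegral_nonneg measurableSet_Ioo fun t ht => mul_nonneg ?_ (hw t)
      exact deriv_nonneg_of_monotoneOn hs.monotoneOn ⟨hx.trans_lt ht.1, ht.2⟩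
    linarith
  · have h1 := h.integral_deriv_mul hn hs₀ (-a) x
    rw [h.defect_eq_zero_of_le hn hs₀ hθ le_rfl] at h1
    have h2 : ∫ t in (-a)..x, deriv s t * (s t * Real.cos (θ t) ^ 2) ≤ 0 := by
      rw [intervalIntegral.integral_of_le hxa.le, integral_Ioc_eq_integral_Ioo]
      refine setIntegral_nonpos measurableSet_Ioo fun t ht =>
        mul_nonpos_of_nonpos_of_nonneg ?_ (hw t)
      have := deriv_nonneg_of_monotoneOn (f := fun x => -s x) hs.antitoneOn.neg
        ⟨ht.1, ht.2.trans hx⟩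
      rw [deriv.fun_neg] at this
      linarith
    linarith

/-- At a zero of `p`, nonnegativity of the defect forces `cos θ = 0`, which is an equilibrium of the
system. By uniqueness `θ` is constant, contradicting its two distinct limits. -/
theorem IsExtremal.momentum_ne_zero (hs : IsUnimodalNotch s₀ a s) (hs₀ : 0 < s₀) {θ p : ℝ → ℝ}
    (hθ : θ ∈ liftingsW) (h : IsExtremal s θ p) (x : ℝ) : p x ≠ 0 := by
  intro hp
  have hpi := Real.pi_pos
  have hn := hs.toIsNotch
  obtain ⟨-, hr⟩ := mem_liftingsW_iff.1 hθ
  have hd := h.defect_nonneg hs hs₀ hθ.1.1 x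
  have hpos := hn.pos hs₀ x
  have hcos : Real.cos (θ x) = 0 := by
    rw [defect, hp] at hd
    have : s x * Real.cos (θ x) = 0 := by nlinarith
    exact (mul_eq_zero.1 this).resolve_left hpos.ne'
  have hconst : IsExtremal s (fun _ => θ x) (fun _ => 0) :=
    ⟨fun y => by simpa using hasDerivAt_const y (θ x),
      fun y => by simpa [hcos] using hasDerivAt_const y (0 : ℝ)⟩
  have heq := h.unique hn hs₀ hconst (x₀ := x) rfl hp
  have h1 := hθ.1.2.1
  have h2 := tendsto_atTop_of_mem_liftingsW hθ
  rw [heq] at h1 h2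
  have h3 := tendsto_nhds_unique h1 tendsto_const_nhds
  have h4 := tendsto_nhds_unique h2 tendsto_const_nhds
  linarith

theorem IsExtremal.strictMono (hs : IsUnimodalNotch s₀ a s) (hs₀ : 0 < s₀) {θ p : ℝ → ℝ}
    (hθ : θ ∈ liftingsW) (h : IsExtremal s θ p) : StrictMono θ := by
  have hpi := Real.pi_pos
  have hn := hs.toIsNotch
  have hne := h.momentum_ne_zero hs hs₀ hθ
  have hex : ∃ x, 0 ≤ p x := by
    by_contra! hneg
    have hanti : Antitone θ := by
      refine antitone_of_deriv_nonpos (fun x => (h.hasDerivAt x).differentiableAt) fun x => ?_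
      rw [h.deriv_eq]
      exact div_nonpos_of_nonpos_of_nonneg (hneg x).le (hn.pos hs₀ x).le
    have h1 := hanti.le_of_tendsto (tendsto_atTop_of_mem_liftingsW hθ) 0
    have h2 := hanti.ge_of_tendsto hθ.1.2.1 0
    linarith
  refine strictMono_of_deriv_pos fun x => ?_
  rw [h.deriv_eq]
  refine div_pos (lt_of_not_ge fun hx => ?_) (hn.pos hs₀ x)
  obtain ⟨y, hy⟩ := mem_range_of_exists_le_of_exists_ge h.continuous_momentum ⟨x, hx⟩ hex
  exact hne y hy

/-! ### Minimizers that meet coincide -/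

theorem glue_mem_liftings {θ η : ℝ → ℝ} {c : ℝ} (hθ : θ ∈ liftings) (hη : η ∈ liftings)
    (hc : θ c = η c) : glue c θ η ∈ liftings := by
  refine ⟨hθ.1.glue hη.1 hc, ?_, ?_⟩
  · exact (memLp_congr_ae (deriv_glue_ae_eq c θ η)).2
      (MemLp.piecewise measurableSet_Iic (hθ.2.1.restrict _) (hη.2.1.restrict _))
  · have : (fun x => Real.cos (glue c θ η x)) =
        (Set.Iic c).piecewise (fun x => Real.cos (θ x)) fun x => Real.cos (η x) := by
      funext x
      by_cases hx : x ≤ c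
      · rw [glue_of_le _ _ hx, Set.piecewise_eq_of_mem _ _ _ (Set.mem_Iic.2 hx)]
      · rw [glue_of_lt _ _ (not_le.1 hx), Set.piecewise_eq_of_notMem _ _ _ (by simpa using hx)]
    rw [this]
    exact MemLp.piecewise measurableSet_Iic (hθ.2.2.restrict _) (hη.2.2.restrict _)

theorem glue_mem_liftingsW {θ η : ℝ → ℝ} {c : ℝ} (hθ : θ ∈ liftingsW) (hη : η ∈ liftingsW)
    (hc : θ c = η c) : glue c θ η ∈ liftingsW := by
  refine mem_liftingsW_iff.2 ⟨⟨glue_mem_liftings hθ.1.1 hη.1.1 hc, ?_, 0, ?_⟩, fun x => ?_⟩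
  · refine hθ.1.2.1.congr' ?_
    filter_upwards [Iic_mem_atBot c] with x hx
    exact (glue_of_le θ η hx).symm
  · have h := tendsto_atTop_of_mem_liftingsW hη
    simp only [CharP.cast_eq_zero, mul_zero, add_zero]
    refine h.congr' ?_
    filter_upwards [Ioi_mem_atTop c] with x hx
    exact (glue_of_lt θ η hx).symm
  · rcases le_or_gt x c with hx | hx
    · rw [glue_of_le _ _ hx]
      exact (mem_liftingsW_iff.1 hθ).2 x
    · rw [glue_of_lt _ _ hx]
      exact (mem_liftingsW_iff.1 hη).2 x

theorem energyDensity_glue_of_lt {c x : ℝ} (s θ η : ℝ → ℝ) (h : x < c) :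
    energyDensity s (glue c θ η) x = energyDensity s θ x := by
  rw [energyDensity, energyDensity, deriv_glue_of_lt _ _ h, glue_of_le _ _ h.le]

theorem energyDensity_glue_of_gt {c x : ℝ} (s θ η : ℝ → ℝ) (h : c < x) :
    energyDensity s (glue c θ η) x = energyDensity s η x := by
  rw [energyDensity, energyDensity, deriv_glue_of_gt _ _ h, glue_of_lt _ _ h]

theorem energy_glue_add_energy_glue (hs : IsNotch s₀ a s) (hs₀ : 0 < s₀) {θ η : ℝ → ℝ} {c : ℝ}
    (hθ : θ ∈ liftings) (hη : η ∈ liftings) (hc : θ c = η c) :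
    energy s (glue c θ η) + energy s (glue c η θ) = energy s θ + energy s η := by
  have h1 := glue_mem_liftings hθ hη hc
  have h2 := glue_mem_liftings hη hθ hc.symm
  rw [hs.energy_eq_integral hs₀ h1, hs.energy_eq_integral hs₀ h2, hs.energy_eq_integral hs₀ hθ,
    hs.energy_eq_integral hs₀ hη,
    ← integral_add (hs.integrable_energyDensity hs₀ h1) (hs.integrable_energyDensity hs₀ h2),
    ← integral_add (hs.integrable_energyDensity hs₀ hθ) (hs.integrable_energyDensity hs₀ hη)]
  refine integral_congr_ae ?_
  have hne : ∀ᵐ x : ℝ, x ≠ c := by simp [ae_iff, measure_singleton]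
  filter_upwards [hne] with x hx
  rcases lt_or_gt_of_ne hx with hx | hx
  · rw [energyDensity_glue_of_lt _ _ _ hx, energyDensity_glue_of_lt _ _ _ hx]
  · rw [energyDensity_glue_of_gt _ _ _ hx, energyDensity_glue_of_gt _ _ _ hx, add_comm]

/-- The two exchanged functions have the same total energy as `θ` and `η`, so both are minimal. -/
theorem IsMinimizer.eq_of_eq (hs : IsNotch s₀ a s) (hs₀ : 0 < s₀) {θ η : ℝ → ℝ} {c : ℝ}
    (hθ : IsMinimizer s liftingsNe θ) (hη : IsMinimizer s liftingsNe η) (hc : θ c = η c) :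
    θ = η := by
  have hθW := hθ.mem_liftingsW hs hs₀
  have hηW := hη.mem_liftingsW hs hs₀
  have h1 := (glue_mem_liftingsW hθW hηW hc).1
  have h2 := (glue_mem_liftingsW hηW hθW hc.symm).1
  have hsum := energy_glue_add_energy_glue hs hs₀ hθ.1.1 hη.1.1 hc
  have hmin : IsMinimizer s liftingsNe (glue c θ η) := by
    refine ⟨h1, fun ζ hζ => ?_⟩
    linarith [hη.2 _ h2, hθ.2 ζ hζ]
  obtain ⟨p, hp⟩ := hθ.exists_isExtremal hs hs₀
  obtain ⟨q, hq⟩ := hη.exists_isExtremal hs hs₀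
  obtain ⟨r, hr⟩ := hmin.exists_isExtremal hs hs₀
  have hpos := (hs.pos hs₀ c).ne'
  -- The glued minimizer is differentiable at `c`: its left derivative is that of `θ` and its right
  -- derivative that of `η`.
  have e1 : p c = r c := by
    have d1 := (hp.hasDerivAt c).hasDerivWithinAt (s := Set.Iic c)
    have d2 := ((hr.hasDerivAt c).hasDerivWithinAt (s := Set.Iic c)).congr
      (fun x hx => (glue_of_le θ η hx).symm) (glue_of_le θ η le_rfl).symm
    exact (div_left_inj' hpos).1 ((uniqueDiffWithinAt_Iic c).eq_deriv _ d1 d2)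
  have e2 : q c = r c := by
    have d1 := (hq.hasDerivAt c).hasDerivWithinAt (s := Set.Ici c)
    have d2 := ((hr.hasDerivAt c).hasDerivWithinAt (s := Set.Ici c)).congr
      (fun x hx => (glue_of_ge hc hx).symm) (glue_of_ge hc le_rfl).symm
    exact (div_left_inj' hpos).1 ((uniqueDiffWithinAt_Ici c).eq_deriv _ d1 d2)
  exact hp.unique hs hs₀ hq hc (e1.trans e2.symm)

/-! ### Reflection and oddness -/

/-- The reflection `x ↦ -θ (-x)`. -/
def reflect (θ : ℝ → ℝ) (x : ℝ) : ℝ := -θ (-x)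

theorem deriv_reflect (θ : ℝ → ℝ) (x : ℝ) : deriv (reflect θ) x = deriv θ (-x) := by
  unfold reflect
  rw [deriv.fun_neg, deriv_comp_neg, neg_neg]

theorem reflect_mem_liftingsW {θ : ℝ → ℝ} (hθ : θ ∈ liftingsW) : reflect θ ∈ liftingsW := by
  have hr := (mem_liftingsW_iff.1 hθ).2
  have hac : LocallyAC (reflect θ) := by
    have h := hθ.1.1.1.comp_neg.const_mul (-1)
    simp only [neg_one_mul] at h
    exact h
  have hmp := Measure.measurePreserving_neg (volume : Measure ℝ)
  have h1 : MemLp (deriv (reflect θ)) 2 volume := by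
    have := hθ.1.1.2.1.comp_measurePreserving hmp
    rwa [show deriv (reflect θ) = deriv θ ∘ Neg.neg from funext (deriv_reflect θ)]
  have h2 : MemLp (fun x => Real.cos (reflect θ x)) 2 volume := by
    have := hθ.1.1.2.2.comp_measurePreserving hmp
    simpa [reflect, Function.comp_def] using this
  have h3 : Tendsto (reflect θ) atBot (𝓝 (-(Real.pi / 2))) :=
    ((tendsto_atTop_of_mem_liftingsW hθ).comp tendsto_neg_atBot_atTop).neg
  have h4 : Tendsto (reflect θ) atTop (𝓝 (Real.pi / 2)) := by
    have h := (hθ.1.2.1.comp tendsto_neg_atTop_atBot).neg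
    rwa [neg_neg] at h
  refine mem_liftingsW_iff.2 ⟨⟨⟨hac, h1, h2⟩, h3, 0, by simpa using h4⟩, fun x => ?_⟩
  exact ⟨neg_le_neg (hr (-x)).2, neg_le.1 (hr (-x)).1⟩

theorem energy_reflect (heven : Function.Even s) (θ : ℝ → ℝ) :
    energy s (reflect θ) = energy s θ := by
  unfold energy
  have h1 : ∫ x, deriv (reflect θ) x ^ 2 * s x = ∫ x, deriv θ x ^ 2 * s x := by
    rw [← integral_neg_eq_self (fun x => deriv θ x ^ 2 * s x)]
    simp only [deriv_reflect, heven _]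
  have h2 : ∫ x, Real.cos (reflect θ x) ^ 2 * s x = ∫ x, Real.cos (θ x) ^ 2 * s x := by
    rw [← integral_neg_eq_self (fun x => Real.cos (θ x) ^ 2 * s x)]
    simp only [reflect, Real.cos_neg, heven _]
  rw [h1, h2]

theorem IsMinimizer.reflect (hs : IsNotch s₀ a s) (hs₀ : 0 < s₀) (heven : Function.Even s)
    {θ : ℝ → ℝ} (h : IsMinimizer s liftingsNe θ) : IsMinimizer s liftingsNe (reflect θ) :=
  ⟨(reflect_mem_liftingsW (h.mem_liftingsW hs hs₀)).1, fun η hη => by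
    rw [energy_reflect heven]; exact h.2 η hη⟩

theorem cos_sq_lt_of_add_neg {u v : ℝ} (hu : -(Real.pi / 2) ≤ u) (huv : u < v)
    (h : v + u < 0) : Real.cos u ^ 2 < Real.cos v ^ 2 := by
  have hpi := Real.pi_pos
  have h1 : Real.cos u < Real.cos v := by
    rw [← Real.cos_neg u, ← Real.cos_abs v]
    exact Real.cos_lt_cos_of_nonneg_of_le_pi (abs_nonneg v) (by linarith)
      (abs_lt.2 ⟨by linarith, by linarith⟩)
  have h2 : 0 ≤ Real.cos u := Real.cos_nonneg_of_mem_Icc ⟨hu, by linarith⟩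
  nlinarith

theorem IsSymmetricNotch.eq_one_of_deriv_ae_eq_zero (hs : IsSymmetricNotch s₀ a s)
    (h : ∀ᵐ x : ℝ, x ∈ Set.Ioc 0 a → deriv s x = 0) (x : ℝ) : s x = 1 := by
  have hn := hs.toIsNotch
  -- The notch condition says nothing at the edge itself; the value comes from continuity on the
  -- right.
  have hsa : s a = 1 := by
    refine tendsto_nhds_unique (hn.continuous.continuousWithinAt (s := Set.Ioi a) (x := a))
      (tendsto_const_nhds.congr' ?_)
    filter_upwards [self_mem_nhdsWithin] with y hy
    exact (hn.eq_one y fun h' => (not_le.2 hy) h'.2).symm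
  have key : ∀ y, 0 ≤ y → s y = 1 := by
    intro y hy
    rcases le_or_gt y a with hya | hya
    · have h1 := hn.locallyAC.integral_deriv y a
      have h2 : ∫ t in y..a, deriv s t = ∫ t in y..a, (0 : ℝ) := by
        refine intervalIntegral.integral_congr_ae ?_
        filter_upwards [h] with t ht hty
        rw [Set.uIoc_of_le hya] at hty
        exact ht ⟨hy.trans_lt hty.1, hty.2⟩
      rw [h2, intervalIntegral.integral_zero] at h1
      linarith
    · exact hn.eq_one y fun h' => (not_le.2 hya) h'.2
  rcases le_total 0 x with hx | hx
  · exact key x hx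
  · rw [← hs.even x]
    exact key _ (by linarith)

/-- The defect vanishes at both edges, so `∫ s s' cos² θ = 0` over `[-a, a]`. As `s'` is odd, this
folds to `∫ s(t) s'(t) (cos² θ(t) - cos² θ(-t)) dt = 0` over `(0, a]`. The bracket is positive and
`s' ≥ 0`, so `s' = 0` almost everywhere there. -/
theorem IsExtremal.eq_one_of_add_neg (hs : IsSymmetricNotch s₀ a s) (hs₀ : 0 < s₀) (ha : 0 < a)
    {θ p : ℝ → ℝ} (hθ : θ ∈ liftingsW) (h : IsExtremal s θ p) (hmono : StrictMono θ)
    (hneg : ∀ x, θ x + θ (-x) < 0) (x : ℝ) : s x = 1 := by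
  have hn := hs.toIsNotch
  refine hs.eq_one_of_deriv_ae_eq_zero ?_ x
  set f : ℝ → ℝ := fun t => deriv s t * (s t * Real.cos (θ t) ^ 2) with hf
  set g : ℝ → ℝ := fun t => deriv s t * (s t * Real.cos (θ (-t)) ^ 2) with hg
  have hθc := h.continuous
  have hsc := hn.continuous
  have hfi : ∀ u v, IntervalIntegrable f volume u v := fun u v =>
    (hn.locallyAC.intervalIntegrable_deriv u v).mul_continuousOn
      (Continuous.continuousOn (by fun_prop))
  have hgi : ∀ u v, IntervalIntegrable g volume u v := fun u v =>
    (hn.locallyAC.intervalIntegrable_deriv u v).mul_continuousOn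
      (Continuous.continuousOn (by fun_prop))
  have h0 : ∫ t in (-a)..a, f t = 0 := by
    have := h.integral_deriv_mul hn hs₀ (-a) a
    rw [h.defect_eq_zero_of_ge hn hs₀ hθ.1.1 le_rfl,
      h.defect_eq_zero_of_le hn hs₀ hθ.1.1 le_rfl] at this
    linarith
  have hdodd : ∀ t, deriv s (-t) = -deriv s t := by
    intro t
    have := deriv_comp_neg s t
    rw [show (fun x => s (-x)) = s from funext hs.even] at this
    linarith
  have h1 : ∫ t in (-a)..0, f t = -∫ t in (0 : ℝ)..a, g t := by
    have := intervalIntegral.integral_comp_neg f (a := 0) (b := a)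
    rw [neg_zero] at this
    rw [← this, ← intervalIntegral.integral_neg]
    congr 1
    funext t
    simp only [hf, hg, hdodd, hs.even t]
    ring
  rw [← intervalIntegral.integral_add_adjacent_intervals (hfi (-a) 0) (hfi 0 a), h1,
    neg_add_eq_sub, ← intervalIntegral.integral_sub (hfi _ _) (hgi _ _),
    intervalIntegral.integral_of_le ha.le] at h0
  have hlt : ∀ t, 0 < t → Real.cos (θ (-t)) ^ 2 < Real.cos (θ t) ^ 2 := fun t ht =>
    cos_sq_lt_of_add_neg ((mem_liftingsW_iff.1 hθ).2 _).1 (hmono (by linarith)) (hneg t)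
  have hnn : 0 ≤ᵐ[volume.restrict (Set.Ioc 0 a)] fun t => f t - g t := by
    rw [EventuallyLE, ← restrict_Ioo_eq_restrict_Ioc]
    filter_upwards [ae_restrict_mem measurableSet_Ioo] with t ht
    have h2 := deriv_nonneg_of_monotoneOn hs.monotoneOn ht
    have h3 := hlt t ht.1
    have h4 := hn.pos hs₀ t
    simp only [hf, hg, Pi.zero_apply, ← mul_sub]
    have h5 := sub_pos.2 h3
    positivity
  rw [integral_eq_zero_iff_of_nonneg_ae hnn ((hfi 0 a).1.sub (hgi 0 a).1)] at h0
  filter_upwards [(ae_restrict_iff' measurableSet_Ioc).1 h0] with t ht htm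
  have h2 := ht htm
  simp only [hf, hg, Pi.zero_apply, ← mul_sub] at h2
  have h3 := hlt t htm.1
  exact (mul_eq_zero.1 h2).resolve_right (mul_pos (hn.pos hs₀ t) (sub_pos.2 h3)).ne'

/-- For `a ≤ 0` the profile is `1` except possibly at `0`, and continuity settles that point. -/
theorem IsUnimodalNotch.pos_of_ne_one (hs : IsUnimodalNotch s₀ a s) (hs1 : ∃ x, s x ≠ 1) :
    0 < a := by
  have hn := hs.toIsNotch
  by_contra! ha
  obtain ⟨x, hx⟩ := hs1
  have hx0 : ∀ y, y ≠ 0 → s y = 1 := fun y hy =>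
    hn.eq_one y fun h' => hy (le_antisymm (h'.2.trans ha) (by linarith [h'.1]))
  have h0 : s 0 = 1 := by
    refine tendsto_nhds_unique (hn.continuous.continuousWithinAt (s := Set.Ioi 0) (x := 0))
      (tendsto_const_nhds.congr' ?_)
    filter_upwards [self_mem_nhdsWithin] with y hy
    exact (hx0 y (ne_of_gt hy)).symm
  rcases eq_or_ne x 0 with rfl | h
  · exact hx h0
  · exact hx (hx0 x h)

theorem IsMinimizer.odd (hs : IsUnimodalNotch s₀ a s) (hsym : IsSymmetricNotch s₀ a s)
    (hs₀ : 0 < s₀) (hs1 : ∃ x, s x ≠ 1) {θ : ℝ → ℝ} (h : IsMinimizer s liftingsNe θ) :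
    Function.Odd θ := by
  have hn := hs.toIsNotch
  have ha := hs.pos_of_ne_one hs1
  have hnot : ∀ η, IsMinimizer s liftingsNe η → ¬ ∀ x, η x + η (-x) < 0 := by
    intro η hη hneg
    obtain ⟨q, hq⟩ := hη.exists_isExtremal hn hs₀
    have hW := hη.mem_liftingsW hn hs₀
    obtain ⟨x, hx⟩ := hs1
    exact hx (hq.eq_one_of_add_neg hsym hs₀ ha hW (hq.strictMono hs hs₀ hW) hneg x)
  have hrefl := h.reflect hn hs₀ hsym.even
  have hθc := h.1.1.1.continuous
  have hc : Continuous fun x => θ x + θ (-x) := by fun_prop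
  -- Excluding a negative sum for both `θ` and its reflection gives points where the sum is `≥ 0`
  -- and `≤ 0`.
  have hzero : ∃ x, θ x + θ (-x) = 0 := by
    have h1 := hnot _ h
    have h2 := hnot _ hrefl
    push Not at h1 h2
    obtain ⟨x, hx⟩ := h1
    obtain ⟨y, hy⟩ := h2
    simp only [NotchedWire.reflect, neg_neg] at hy
    exact mem_range_of_exists_le_of_exists_ge hc ⟨y, by linarith⟩ ⟨x, hx⟩
  obtain ⟨x, hx⟩ := hzero
  have heq := h.eq_of_eq hn hs₀ hrefl (c := x) (by simp only [NotchedWire.reflect]; linarith)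
  intro y
  have := congrFun heq (-y)
  simpa [NotchedWire.reflect] using this

/-! ### Lower bounds for the tails -/

theorem LocallyAC.sin_comp {θ : ℝ → ℝ} (hθ : LocallyAC θ) :
    LocallyAC fun x => Real.sin (θ x) :=
  LocallyAC.lipschitz_comp (f := θ) (g := Real.sin) (K := 1)
    (LipschitzWith.of_dist_le_mul fun x y => by
      simpa [Real.dist_eq] using Real.abs_sin_sub_sin_le x y) hθ

theorem LocallyAC.integral_deriv_mul_cos {θ : ℝ → ℝ} (hθ : LocallyAC θ) (x y : ℝ) :
    ∫ t in x..y, deriv θ t * Real.cos (θ t) = Real.sin (θ y) - Real.sin (θ x) := by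
  rw [← hθ.sin_comp.integral_deriv]
  refine intervalIntegral.integral_congr_ae ?_
  filter_upwards [hθ.ae_differentiableAt] with t ht _
  rw [ht.hasDerivAt.sin.deriv, mul_comm]

theorem integrable_deriv_mul_cos {θ : ℝ → ℝ} (hθ : θ ∈ liftings) :
    Integrable fun x => deriv θ x * Real.cos (θ x) := hθ.2.1.integrable_mul hθ.2.2

theorem IsNotch.deriv_mul_cos_le (hs : IsNotch s₀ a s) (θ : ℝ → ℝ) {x : ℝ}
    (hx : x ∉ Set.Icc (-a) a) : deriv θ x * Real.cos (θ x) ≤ energyDensity s θ x := by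
  rw [energyDensity, hs.eq_one x hx]
  nlinarith [sq_nonneg (deriv θ x - Real.cos (θ x))]

/-- The minorant `θ' cos θ` of the density is the derivative of `sin θ`, and `sin θ` tends to `1`.
-/
theorem one_sub_sin_le_integral_Ioi (hs : IsNotch s₀ a s) (hs₀ : 0 < s₀) {θ : ℝ → ℝ}
    (hθ : θ ∈ liftingsW) : 1 - Real.sin (θ a) ≤ ∫ x in Set.Ioi a, energyDensity s θ x := by
  have hi := integrable_deriv_mul_cos hθ.1.1
  have h1 := intervalIntegral_tendsto_integral_Ioi a hi.integrableOn tendsto_id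
  simp only [hθ.1.1.1.integral_deriv_mul_cos, id] at h1
  have h2 := ((Real.continuous_sin.tendsto _).comp
    (tendsto_atTop_of_mem_liftingsW hθ)).sub_const (Real.sin (θ a))
  rw [Real.sin_pi_div_two] at h2
  rw [tendsto_nhds_unique h2 h1]
  refine setIntegral_mono_on hi.integrableOn
    (hs.integrable_energyDensity hs₀ hθ.1.1).integrableOn measurableSet_Ioi fun x hx => ?_
  exact hs.deriv_mul_cos_le θ fun h => (not_le.2 hx) h.2

theorem one_add_sin_le_integral_Iic (hs : IsNotch s₀ a s) (hs₀ : 0 < s₀) {θ : ℝ → ℝ}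
    (hθ : θ ∈ liftingsW) :
    1 + Real.sin (θ (-a)) ≤ ∫ x in Set.Iic (-a), energyDensity s θ x := by
  have hi := integrable_deriv_mul_cos hθ.1.1
  have h1 := intervalIntegral_tendsto_integral_Iic (-a) hi.integrableOn tendsto_id
  simp only [hθ.1.1.1.integral_deriv_mul_cos, id] at h1
  have h2 := ((Real.continuous_sin.tendsto _).comp hθ.1.2.1).const_sub (Real.sin (θ (-a)))
  rw [Real.sin_neg, Real.sin_pi_div_two, sub_neg_eq_add] at h2
  rw [add_comm, tendsto_nhds_unique h2 h1, integral_Iic_eq_integral_Iio,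
    integral_Iic_eq_integral_Iio]
  refine setIntegral_mono_on hi.integrableOn
    (hs.integrable_energyDensity hs₀ hθ.1.1).integrableOn measurableSet_Iio fun x hx => ?_
  exact hs.deriv_mul_cos_le θ fun h => (not_le.2 hx) h.1

/-- The energy on `(-a, a]` together with the least energy of the two tails. -/
noncomputable def coreEnergy (a : ℝ) (s θ : ℝ → ℝ) : ℝ :=
  (∫ x in Set.Ioc (-a) a, energyDensity s θ x) + (1 + Real.sin (θ (-a))) + (1 - Real.sin (θ a))

theorem integral_eq_add_add {f : ℝ → ℝ} (hf : Integrable f) (ha : 0 ≤ a) :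
    ∫ x, f x = (∫ x in Set.Ioc (-a) a, f x) + (∫ x in Set.Iic (-a), f x) +
      ∫ x in Set.Ioi a, f x := by
  rw [← integral_add_compl (measurableSet_Iic (a := a)) hf, Set.compl_Iic,
    ← Set.Iic_union_Ioc_eq_Iic (show -a ≤ a by linarith),
    setIntegral_union (Set.Iic_disjoint_Ioc le_rfl) measurableSet_Ioc hf.integrableOn hf.integrableOn]
  ring

theorem coreEnergy_le_energy (hs : IsNotch s₀ a s) (hs₀ : 0 < s₀) (ha : 0 ≤ a) {θ : ℝ → ℝ}
    (hθ : θ ∈ liftingsW) : coreEnergy a s θ ≤ energy s θ := by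
  rw [hs.energy_eq_integral hs₀ hθ.1.1,
    integral_eq_add_add (hs.integrable_energyDensity hs₀ hθ.1.1) ha, coreEnergy]
  linarith [one_sub_sin_le_integral_Ioi hs hs₀ hθ, one_add_sin_le_integral_Iic hs hs₀ hθ]

/-! ### Kinks, the optimal tails -/

/-- The profile `π/2 - 2 arctan (k e^{-x})`, which solves `θ' = cos θ`. -/
noncomputable def kink (k x : ℝ) : ℝ := Real.pi / 2 - 2 * Real.arctan (k * Real.exp (-x))

theorem cos_kink (k x : ℝ) :
    Real.cos (kink k x) = 2 * (k * Real.exp (-x)) / (1 + (k * Real.exp (-x)) ^ 2) := by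
  rw [kink, Real.cos_pi_div_two_sub, Real.sin_two_mul, Real.sin_arctan, Real.cos_arctan]
  have h : 0 < 1 + (k * Real.exp (-x)) ^ 2 := by positivity
  have h2 := Real.sq_sqrt h.le
  have h3 := Real.sqrt_pos.2 h
  set r := √(1 + (k * Real.exp (-x)) ^ 2)
  rw [← h2]
  field_simp

theorem hasDerivAt_kink (k x : ℝ) : HasDerivAt (kink k) (Real.cos (kink k x)) x := by
  have h1 : HasDerivAt (fun x => k * Real.exp (-x)) (k * (Real.exp (-x) * -1)) x :=
    (((hasDerivAt_id x).neg).exp).const_mul k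
  have h2 := (h1.arctan.const_mul 2).const_sub (Real.pi / 2)
  refine h2.congr_deriv ?_
  rw [cos_kink]
  have h : 0 < 1 + (k * Real.exp (-x)) ^ 2 := by positivity
  field_simp

theorem deriv_kink (k x : ℝ) : deriv (kink k) x = Real.cos (kink k x) :=
  (hasDerivAt_kink k x).deriv

theorem continuous_kink (k : ℝ) : Continuous (kink k) :=
  continuous_iff_continuousAt.2 fun x => (hasDerivAt_kink k x).continuousAt

theorem locallyAC_kink (k : ℝ) : LocallyAC (kink k) := by
  refine locallyAC_of_contDiff (contDiff_one_iff_deriv.2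
    ⟨fun x => (hasDerivAt_kink k x).differentiableAt, ?_⟩)
  rw [show deriv (kink k) = _ from funext (deriv_kink k)]
  exact Real.continuous_cos.comp (continuous_kink k)

theorem kink_mem {k : ℝ} (hk : 0 ≤ k) (x : ℝ) :
    kink k x ∈ Set.Icc (-(Real.pi / 2)) (Real.pi / 2) := by
  have h1 := Real.arctan_lt_pi_div_two (k * Real.exp (-x))
  have h2 : 0 ≤ Real.arctan (k * Real.exp (-x)) := Real.arctan_nonneg.2 (by positivity)
  unfold kink
  exact ⟨by linarith, by linarith⟩

theorem tendsto_kink (k : ℝ) : Tendsto (kink k) atTop (𝓝 (Real.pi / 2)) := by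
  have h1 : Tendsto (fun x : ℝ => k * Real.exp (-x)) atTop (𝓝 0) := by
    simpa using (Real.tendsto_exp_neg_atTop_nhds_zero).const_mul k
  have h2 := (((Real.continuous_arctan.tendsto 0).comp h1).const_mul 2).const_sub (Real.pi / 2)
  rw [Real.arctan_zero, mul_zero, sub_zero] at h2
  exact h2

theorem hasDerivAt_sin_kink (k x : ℝ) :
    HasDerivAt (fun x => Real.sin (kink k x)) (Real.cos (kink k x) ^ 2) x := by
  rw [sq]
  exact (hasDerivAt_kink k x).sin

theorem tendsto_sin_kink (k : ℝ) : Tendsto (fun x => Real.sin (kink k x)) atTop (𝓝 1) := by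
  have := (Real.continuous_sin.tendsto _).comp (tendsto_kink k)
  rwa [Real.sin_pi_div_two] at this

/-- `cos²` of the kink is the nonnegative derivative of `sin` of the kink, which has a finite limit.
-/
theorem integrableOn_cos_kink_sq (k b : ℝ) :
    IntegrableOn (fun x => Real.cos (kink k x) ^ 2) (Set.Ioi b) :=
  integrableOn_Ioi_deriv_of_nonneg
    (hasDerivAt_sin_kink k b).continuousAt.continuousWithinAt
    (fun x _ => hasDerivAt_sin_kink k x) (fun _ _ => sq_nonneg _) (tendsto_sin_kink k)

theorem integral_cos_kink_sq (k b : ℝ) :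
    ∫ x in Set.Ioi b, Real.cos (kink k x) ^ 2 = 1 - Real.sin (kink k b) :=
  integral_Ioi_of_hasDerivAt_of_tendsto
    (hasDerivAt_sin_kink k b).continuousAt.continuousWithinAt
    (fun x _ => hasDerivAt_sin_kink k x) (integrableOn_cos_kink_sq k b) (tendsto_sin_kink k)

/-- The value `π/2` is reached with `k = 0`, the constant kink; `-π/2` is excluded because it would
need `k = ∞`. -/
theorem exists_kink_eq {α : ℝ} (h1 : -(Real.pi / 2) < α) (h2 : α ≤ Real.pi / 2) (b : ℝ) :
    ∃ k, 0 ≤ k ∧ kink k b = α := by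
  have hpi := Real.pi_pos
  refine ⟨Real.tan ((Real.pi / 2 - α) / 2) * Real.exp b, ?_, ?_⟩
  · exact mul_nonneg (Real.tan_nonneg_of_nonneg_of_le_pi_div_two (by linarith) (by linarith))
      (Real.exp_pos _).le
  · rw [kink, mul_assoc, ← Real.exp_add, add_neg_cancel, Real.exp_zero, mul_one,
      Real.arctan_tan (by linarith) (by linarith)]
    ring

/-! ### The direct method on the notch -/

/-- Sequential Banach–Alaoglu in the dual, brought back to `E` by the Riesz isomorphism. -/
theorem exists_subseq_tendsto_inner {E : Type*} [NormedAddCommGroup E] [InnerProductSpace ℝ E]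
    [CompleteSpace E] [TopologicalSpace.SeparableSpace E] {u : ℕ → E} {r : ℝ}
    (hu : ∀ n, ‖u n‖ ≤ r) : ∃ (w : E) (φ : ℕ → ℕ), StrictMono φ ∧
      ∀ v, Tendsto (fun n => inner ℝ (u (φ n)) v) atTop (𝓝 (inner ℝ w v)) := by
  obtain ⟨f, -, φ, hφ, hf⟩ := WeakDual.isSeqCompact_closedBall ℝ E 0 r
    (x := fun n => StrongDual.toWeakDual (InnerProductSpace.toDual ℝ E (u n)))
    (fun n => by simpa using hu n)
  refine ⟨(InnerProductSpace.toDual ℝ E).symm (WeakDual.toStrongDual f), φ, hφ, fun v => ?_⟩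
  have h := ((WeakDual.eval_continuous (𝕜 := ℝ) v).tendsto f).comp hf
  rw [InnerProductSpace.toDual_symm_apply]
  exact h

theorem inner_toLp {μ : Measure ℝ} {f g : ℝ → ℝ} (hf : MemLp f 2 μ) (hg : MemLp g 2 μ) :
    inner ℝ (hf.toLp f) (hg.toLp g) = ∫ x, f x * g x ∂μ := by
  rw [L2.inner_def]
  refine integral_congr_ae ?_
  filter_upwards [hf.coeFn_toLp, hg.coeFn_toLp] with x h1 h2
  rw [h1, h2]
  simp [mul_comm]

/-- Admissible functions for the problem on `[-a, a]`. -/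
def coreClass (a : ℝ) : Set (ℝ → ℝ) :=
  {θ | LocallyAC θ ∧ MemLp (deriv θ) 2 (volume.restrict (Set.Ioc (-a) a)) ∧
    ∀ x ∈ Set.Icc (-a) a, θ x ∈ Set.Icc (-(Real.pi / 2)) (Real.pi / 2)}

/-- The part of `coreEnergy` that does not involve the derivative. -/
noncomputable def corePotential (a : ℝ) (s θ : ℝ → ℝ) : ℝ :=
  1 / 2 * (∫ x in Set.Ioc (-a) a, Real.cos (θ x) ^ 2 * s x) + (1 + Real.sin (θ (-a))) +
    (1 - Real.sin (θ a))

theorem coreEnergy_eq (hs : IsNotch s₀ a s) (hs₀ : 0 < s₀) {θ : ℝ → ℝ} (hθ : LocallyAC θ)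
    (hd : MemLp (deriv θ) 2 (volume.restrict (Set.Ioc (-a) a))) :
    coreEnergy a s θ =
      1 / 2 * (∫ x in Set.Ioc (-a) a, deriv θ x ^ 2 * s x) + corePotential a s θ := by
  have hc : Continuous fun x => Real.cos (θ x) ^ 2 * s x := by
    have := hθ.continuous
    have := hs.continuous
    fun_prop
  have h1 : Integrable (fun x => deriv θ x ^ 2 * s x) (volume.restrict (Set.Ioc (-a) a)) :=
    hs.integrable_mul hs₀ hd.integrable_sq
  have h2 : Integrable (fun x => Real.cos (θ x) ^ 2 * s x) (volume.restrict (Set.Ioc (-a) a)) :=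
    hc.integrableOn_Ioc
  have e : ∀ x, energyDensity s θ x =
      1 / 2 * (deriv θ x ^ 2 * s x) + 1 / 2 * (Real.cos (θ x) ^ 2 * s x) := fun x => by
    rw [energyDensity]; ring
  rw [coreEnergy, corePotential]
  simp_rw [e]
  rw [integral_add (h1.const_mul _) (h2.const_mul _), integral_const_mul, integral_const_mul]
  ring

theorem corePotential_nonneg (hs : IsNotch s₀ a s) (hs₀ : 0 < s₀) (θ : ℝ → ℝ) :
    0 ≤ corePotential a s θ := by
  have h1 : 0 ≤ ∫ x in Set.Ioc (-a) a, Real.cos (θ x) ^ 2 * s x :=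
    integral_nonneg fun x => mul_nonneg (sq_nonneg _) (hs.pos hs₀ x).le
  have h2 := Real.neg_one_le_sin (θ (-a))
  have h3 := Real.sin_le_one (θ a)
  rw [corePotential]
  linarith

theorem tendsto_corePotential (hs : IsNotch s₀ a s) (hs₀ : 0 < s₀) (ha : 0 ≤ a)
    {θ : ℝ → ℝ} {u : ℕ → ℝ → ℝ} (hu : ∀ n, Continuous (u n))
    (h : ∀ x ∈ Set.Icc (-a) a, Tendsto (fun n => u n x) atTop (𝓝 (θ x))) :
    Tendsto (fun n => corePotential a s (u n)) atTop (𝓝 (corePotential a s θ)) := by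
  have h1 : Tendsto (fun n => ∫ x in Set.Ioc (-a) a, Real.cos (u n x) ^ 2 * s x) atTop
      (𝓝 (∫ x in Set.Ioc (-a) a, Real.cos (θ x) ^ 2 * s x)) := by
    refine tendsto_integral_of_dominated_convergence (fun _ => 1)
      (fun n => ?_) (integrable_const 1) (fun n => Eventually.of_forall fun x => ?_) ?_
    · have := hu n
      have := hs.continuous
      exact Continuous.aestronglyMeasurable (by fun_prop)
    · rw [Real.norm_of_nonneg (mul_nonneg (sq_nonneg _) (hs.pos hs₀ x).le)]
      exact mul_le_one₀ (Real.cos_sq_le_one _) (hs.pos hs₀ x).le (hs.mem_Icc x).2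
    · filter_upwards [ae_restrict_mem measurableSet_Ioc] with x hx
      exact (((Real.continuous_cos.tendsto _).comp
        (h x (Set.Ioc_subset_Icc_self hx))).pow 2).mul_const _
  have h2 := (Real.continuous_sin.tendsto _).comp (h (-a) ⟨le_rfl, by linarith⟩)
  have h3 := (Real.continuous_sin.tendsto _).comp (h a ⟨by linarith, le_rfl⟩)
  exact ((h1.const_mul (1 / 2)).add (h2.const_add 1)).add (h3.const_sub 1)

theorem IsNotch.memLp_sqrt_mul (hs : IsNotch s₀ a s) {μ : Measure ℝ} {f : ℝ → ℝ}
    (hf : MemLp f 2 μ) : MemLp (fun x => √(s x) * f x) 2 μ := by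
  refine hf.mono (hs.continuous.sqrt.aestronglyMeasurable.mul hf.aestronglyMeasurable)
    (Eventually.of_forall fun x => ?_)
  rw [norm_mul, Real.norm_of_nonneg (Real.sqrt_nonneg _)]
  exact mul_le_of_le_one_left (norm_nonneg _) (Real.sqrt_le_one.2 (hs.mem_Icc x).2)

theorem IsNotch.memLp_sqrt_inv_mul (hs : IsNotch s₀ a s) (hs₀ : 0 < s₀) {μ : Measure ℝ}
    {f : ℝ → ℝ} (hf : MemLp f 2 μ) : MemLp (fun x => (√(s x))⁻¹ * f x) 2 μ := by
  have hc : Continuous fun x => (√(s x))⁻¹ :=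
    hs.continuous.sqrt.inv₀ fun x => (Real.sqrt_pos.2 (hs.pos hs₀ x)).ne'
  refine MemLp.of_le_mul (c := (√s₀)⁻¹) hf
    (hc.aestronglyMeasurable.mul hf.aestronglyMeasurable) (Eventually.of_forall fun x => ?_)
  rw [norm_mul, Real.norm_of_nonneg (inv_nonneg.2 (Real.sqrt_nonneg _))]
  refine mul_le_mul_of_nonneg_right ?_ (norm_nonneg _)
  exact inv_anti₀ (Real.sqrt_pos.2 hs₀) (Real.sqrt_le_sqrt (hs.mem_Icc x).1)

/-- The representative of the functional `h ↦ ∫_{-a}^x h / √s`. -/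
noncomputable def evalKernel (s : ℝ → ℝ) (x : ℝ) : ℝ → ℝ :=
  fun t => (√(s t))⁻¹ * (Set.Iic x).indicator (fun _ => (1 : ℝ)) t

theorem memLp_evalKernel (hs : IsNotch s₀ a s) (hs₀ : 0 < s₀) (x : ℝ) :
    MemLp (evalKernel s x) 2 (volume.restrict (Set.Ioc (-a) a)) :=
  hs.memLp_sqrt_inv_mul hs₀ ((memLp_const (1 : ℝ)).indicator measurableSet_Iic)

/-- Writes increments of `θ` as inner products with `√s θ'`, so that weak convergence of the latter
yields pointwise convergence of `θ`. -/
theorem integral_eq_integral_evalKernel (hs : IsNotch s₀ a s) (hs₀ : 0 < s₀) {g h : ℝ → ℝ}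
    {x : ℝ} (hx : x ∈ Set.Icc (-a) a)
    (hgh : ∀ᵐ t ∂volume.restrict (Set.Ioc (-a) a), √(s t) * g t = h t) :
    ∫ t in (-a)..x, g t = ∫ t in Set.Ioc (-a) a, h t * evalKernel s x t := by
  have h1 : Set.Ioc (-a) x = Set.Ioc (-a) a ∩ Set.Iic x := by
    rw [Set.Ioc_inter_Iic, min_eq_right hx.2]
  rw [intervalIntegral.integral_of_le hx.1, h1, ← setIntegral_indicator measurableSet_Iic]
  refine integral_congr_ae ?_
  filter_upwards [hgh] with t ht
  rw [← ht, evalKernel]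
  have hpos := (Real.sqrt_pos.2 (hs.pos hs₀ t)).ne'
  by_cases hm : t ∈ Set.Iic x
  · rw [Set.indicator_of_mem hm, Set.indicator_of_mem hm]
    field_simp
  · rw [Set.indicator_of_notMem hm, Set.indicator_of_notMem hm]
    simp

theorem zero_mem_coreClass (a : ℝ) : (fun _ => 0) ∈ coreClass a := by
  have hpi := Real.pi_pos
  refine ⟨locallyAC_of_lipschitz (LipschitzWith.const 0), by simp, fun x _ => ?_⟩
  exact ⟨by linarith, by linarith⟩

/-- With `h = √s θ'` the kinetic term is exactly `‖h‖²/2`, so weak `L²` compactness applies. The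
potential term converges by pointwise convergence and domination, and the norm is weakly lower
semicontinuous. -/
theorem exists_coreEnergy_minimizer (hs : IsNotch s₀ a s) (hs₀ : 0 < s₀) (ha : 0 ≤ a) :
    ∃ θ ∈ coreClass a, ∀ η ∈ coreClass a, coreEnergy a s θ ≤ coreEnergy a s η := by
  set μ := volume.restrict (Set.Ioc (-a) a) with hμ
  have hone : Fact ((2 : ENNReal) ≠ ⊤) := ⟨by norm_num⟩
  have hkin : ∀ θ : ℝ → ℝ, 0 ≤ ∫ x, deriv θ x ^ 2 * s x ∂μ := fun θ =>
    integral_nonneg fun x => mul_nonneg (sq_nonneg _) (hs.pos hs₀ x).le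
  have hbdd : BddBelow (coreEnergy a s '' coreClass a) := by
    refine ⟨0, ?_⟩
    rintro _ ⟨θ, hθ, rfl⟩
    rw [coreEnergy_eq hs hs₀ hθ.1 hθ.2.1]
    linarith [hkin θ, corePotential_nonneg hs hs₀ θ]
  have hne : (coreEnergy a s '' coreClass a).Nonempty := ⟨_, _, zero_mem_coreClass a, rfl⟩
  obtain ⟨v, hanti, hv, hvm⟩ := exists_seq_tendsto_sInf hne hbdd
  choose u hu huv using hvm
  set I := sInf (coreEnergy a s '' coreClass a) with hI
  have hL : ∀ n, MemLp (fun x => √(s x) * deriv (u n) x) 2 μ := fun n =>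
    hs.memLp_sqrt_mul (hu n).2.1
  set h : ℕ → Lp ℝ 2 μ := fun n => (hL n).toLp _ with hh
  have hinner : ∀ n, inner ℝ (h n) (h n) = ∫ x, deriv (u n) x ^ 2 * s x ∂μ := by
    intro n
    rw [hh, inner_toLp]
    congr 1
    funext x
    have := Real.mul_self_sqrt (hs.pos hs₀ x).le
    linear_combination (deriv (u n) x ^ 2) * this
  have hval : ∀ n, v n = 1 / 2 * inner ℝ (h n) (h n) + corePotential a s (u n) := by
    intro n
    rw [hinner, ← coreEnergy_eq hs hs₀ (hu n).1 (hu n).2.1, huv]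
  have hnorm : ∀ n, ‖h n‖ ≤ √(2 * v 0) := by
    intro n
    refine Real.le_sqrt_of_sq_le ?_
    rw [← real_inner_self_eq_norm_sq]
    linarith [hval n, corePotential_nonneg hs hs₀ (u n), hanti (Nat.zero_le n)]
  obtain ⟨w, φ, hφ, hw⟩ := exists_subseq_tendsto_inner hnorm
  have hcmem : ∀ n, u (φ n) (-a) ∈ Set.Icc (-(Real.pi / 2)) (Real.pi / 2) := fun n =>
    (hu _).2.2 _ ⟨le_rfl, by linarith⟩
  -- Weak convergence controls only derivatives; the value at `-a` is extracted separately by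
  -- compactness.
  obtain ⟨c, -, ψ, hψ, hc⟩ := isCompact_Icc.tendsto_subseq hcmem
  set χ := φ ∘ ψ with hχ
  have hχm : Tendsto χ atTop atTop := (hφ.comp hψ).tendsto_atTop
  have hwχ : ∀ k, Tendsto (fun n => inner ℝ (h (χ n)) k) atTop (𝓝 (inner ℝ w k)) := fun k =>
    (hw k).comp hψ.tendsto_atTop
  have hwL : MemLp w 2 μ := Lp.memLp w
  have hgL : MemLp (fun x => (√(s x))⁻¹ * w x) 2 μ := hs.memLp_sqrt_inv_mul hs₀ hwL
  set G := (Set.Ioc (-a) a).indicator fun x => (√(s x))⁻¹ * w x with hG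
  have hGi : Integrable G :=
    IntegrableOn.integrable_indicator (hgL.integrable (by norm_num)) measurableSet_Ioc
  set θ : ℝ → ℝ := fun x => c + ∫ t in (-a)..x, G t with hθ
  have hθac : LocallyAC θ := locallyAC_integral hGi.locallyIntegrable _ _
  have hθd : deriv θ =ᵐ[μ] fun x => (√(s x))⁻¹ * w x := by
    filter_upwards [ae_restrict_of_ae (deriv_integral_ae_eq hGi.locallyIntegrable c (-a)),
      ae_restrict_mem measurableSet_Ioc] with x hx hxm
    rw [hx, hG, Set.indicator_of_mem hxm]
  have hθL : MemLp (deriv θ) 2 μ := (memLp_congr_ae hθd).2 hgL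
  have hlim : ∀ x ∈ Set.Icc (-a) a, Tendsto (fun n => u (χ n) x) atTop (𝓝 (θ x)) := by
    intro x hx
    have h1 : ∀ n, u (χ n) x = u (χ n) (-a) +
        inner ℝ (h (χ n)) ((memLp_evalKernel hs hs₀ x).toLp _) := by
      intro n
      rw [hh, inner_toLp, ← integral_eq_integral_evalKernel hs hs₀ hx
        (Eventually.of_forall fun t => rfl), (hu _).1.integral_deriv]
      ring
    have h2 : θ x = c + inner ℝ w ((memLp_evalKernel hs hs₀ x).toLp _) := by
      rw [← Lp.toLp_coeFn w hwL, inner_toLp, ← integral_eq_integral_evalKernel hs hs₀ (g := G) hx]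
      filter_upwards [ae_restrict_mem measurableSet_Ioc] with t ht
      rw [hG, Set.indicator_of_mem ht]
      exact mul_inv_cancel_left₀ (Real.sqrt_pos.2 (hs.pos hs₀ t)).ne' _
    simp_rw [h1]
    rw [h2]
    exact hc.add (hwχ _)
  have hθX : θ ∈ coreClass a := ⟨hθac, hθL, fun x hx =>
    isClosed_Icc.mem_of_tendsto (hlim x hx) (Eventually.of_forall fun n => (hu _).2.2 x hx)⟩
  have hpot := tendsto_corePotential hs hs₀ ha (fun n => (hu (χ n)).1.continuous) hlim
  have hself : Tendsto (fun n => inner ℝ (h (χ n)) (h (χ n))) atTop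
      (𝓝 (2 * (I - corePotential a s θ))) := by
    refine (((hv.comp hχm).sub hpot).const_mul 2).congr fun n => ?_
    have := hval (χ n)
    simp only [Function.comp_apply]
    linarith
  -- Weak lower semicontinuity, from expanding `‖h (χ n) - w‖² ≥ 0` and passing to the limit.
  have hww : inner ℝ w w ≤ 2 * (I - corePotential a s θ) := by
    have h1 : ∀ n, 2 * inner ℝ (h (χ n)) w - inner ℝ w w ≤ inner ℝ (h (χ n)) (h (χ n)) := by
      intro n
      have := real_inner_self_nonneg (x := h (χ n) - w)
      rw [real_inner_sub_sub_self] at this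
      linarith
    have h2 := le_of_tendsto_of_tendsto' (((hwχ w).const_mul 2).sub_const (inner ℝ w w)) hself h1
    linarith
  have hkw : ∫ x, deriv θ x ^ 2 * s x ∂μ = inner ℝ w w := by
    rw [← Lp.toLp_coeFn w hwL, inner_toLp]
    refine integral_congr_ae ?_
    filter_upwards [hθd] with x hx
    have h1 := Real.mul_self_sqrt (hs.pos hs₀ x).le
    have h2 := (Real.sqrt_pos.2 (hs.pos hs₀ x)).ne'
    rw [hx]
    nth_rewrite 2 [← h1]
    field_simp
  refine ⟨θ, hθX, fun η hη => ?_⟩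
  have hle : coreEnergy a s θ ≤ I := by
    rw [coreEnergy_eq hs hs₀ hθac hθL, hkw]
    linarith
  exact hle.trans (csInf_le hbdd ⟨η, hη, rfl⟩)

/-! ### Extending the core minimizer to the line -/

/-- For the kink the density is `s cos²`. With `s = 1` its integral and the boundary terms telescope
to `2`; a point where `s < 1` makes the inequality strict, as the cosine of the kink is positive. -/
theorem exists_mem_coreClass_lt_two (hs : IsNotch s₀ a s) (ha : 0 < a)
    (hs1 : ∃ x, s x ≠ 1) : ∃ θ ∈ coreClass a, coreEnergy a s θ < 2 := by
  have hk := continuous_kink 1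
  have hsc := hs.continuous
  have hc : Continuous fun x => Real.cos (kink 1 x) ^ 2 := by fun_prop
  have hd : MemLp (deriv (kink 1)) 2 (volume.restrict (Set.Ioc (-a) a)) := by
    rw [show deriv (kink 1) = _ from funext (deriv_kink 1)]
    exact MemLp.of_bound (Real.continuous_cos.comp hk).aestronglyMeasurable 1
      (Eventually.of_forall fun x => Real.abs_cos_le_one _)
  refine ⟨kink 1, ⟨locallyAC_kink 1, hd, fun x _ => kink_mem zero_le_one x⟩, ?_⟩
  have h1 : ∫ x in (-a)..a, Real.cos (kink 1 x) ^ 2 =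
      Real.sin (kink 1 a) - Real.sin (kink 1 (-a)) :=
    intervalIntegral.integral_eq_sub_of_hasDerivAt (fun x _ => hasDerivAt_sin_kink 1 x)
      (hc.intervalIntegrable _ _)
  have h2 : ∫ x in (-a)..a, energyDensity s (kink 1) x <
      ∫ x in (-a)..a, Real.cos (kink 1 x) ^ 2 := by
    have e : energyDensity s (kink 1) = fun x => Real.cos (kink 1 x) ^ 2 * s x := by
      funext x
      rw [energyDensity, deriv_kink]
      ring
    rw [e]
    obtain ⟨x, hx⟩ := hs1
    have hxm : x ∈ Set.Icc (-a) a := by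
      by_contra h
      exact hx (hs.eq_one x h)
    refine intervalIntegral.integral_lt_integral_of_continuousOn_of_le_of_exists_lt
      (by linarith) (hc.mul hsc).continuousOn hc.continuousOn
      (fun y _ => mul_le_of_le_one_right (sq_nonneg _) (hs.mem_Icc y).2) ⟨x, hxm, ?_⟩
    have hpos : 0 < Real.cos (kink 1 x) := by
      rw [cos_kink]
      positivity
    exact mul_lt_of_lt_one_right (by positivity) (lt_of_le_of_ne (hs.mem_Icc x).2 hx)
  rw [intervalIntegral.integral_of_le (by linarith)] at h2
  rw [coreEnergy]
  linarith

/-- Either excluded endpoint value makes one boundary term equal to `2`, and the other terms are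
nonnegative. -/
theorem endpoints_ne_of_coreEnergy_lt (hs : IsNotch s₀ a s) (hs₀ : 0 < s₀) {θ : ℝ → ℝ}
    (h : coreEnergy a s θ < 2) : θ a ≠ -(Real.pi / 2) ∧ θ (-a) ≠ Real.pi / 2 := by
  have h1 : 0 ≤ ∫ x in Set.Ioc (-a) a, energyDensity s θ x :=
    integral_nonneg fun x => mul_nonneg (by positivity) (hs.pos hs₀ x).le
  have h2 := Real.neg_one_le_sin (θ (-a))
  have h3 := Real.sin_le_one (θ a)
  rw [coreEnergy] at h
  constructor <;> intro h'
  · rw [h', Real.sin_neg, Real.sin_pi_div_two] at h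
    linarith
  · rw [h', Real.sin_pi_div_two] at h
    linarith

theorem memLp_cos_kink (k b : ℝ) :
    MemLp (fun x => Real.cos (kink k x)) 2 (volume.restrict (Set.Ioi b)) :=
  (memLp_two_iff_integrable_sq
    (Real.continuous_cos.comp (continuous_kink k)).aestronglyMeasurable).2
    (integrableOn_cos_kink_sq k b)

theorem memLp_cos_reflect_kink (k b : ℝ) :
    MemLp (fun x => Real.cos (reflect (kink k) x)) 2 (volume.restrict (Set.Iio (-b))) := by
  have hmp := (Measure.measurePreserving_neg (volume : Measure ℝ)).restrict_preimage
    (measurableSet_Ioi (a := b))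
  have h := (memLp_cos_kink k b).comp_measurePreserving hmp
  have hp : (Neg.neg ⁻¹' Set.Ioi b : Set ℝ) = Set.Iio (-b) := by
    ext x
    simp
  rw [hp] at h
  simpa [reflect, Function.comp_def] using h

theorem deriv_reflect_kink (k x : ℝ) :
    deriv (reflect (kink k)) x = Real.cos (reflect (kink k) x) := by
  rw [deriv_reflect, deriv_kink, reflect, Real.cos_neg]

/-- A kink satisfies `θ' = cos θ`, the equality case of the tail bound, and so does its reflection;
attaching one on each side costs exactly the boundary terms. -/
theorem exists_extension (hs : IsNotch s₀ a s) (hs₀ : 0 < s₀) (ha : 0 < a) {θ : ℝ → ℝ}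
    (hθ : θ ∈ coreClass a) (h : coreEnergy a s θ < 2) :
    ∃ η ∈ liftingsW, energy s η = coreEnergy a s θ := by
  have hma : a ∈ Set.Icc (-a) a := ⟨by linarith, le_rfl⟩
  have hmna : -a ∈ Set.Icc (-a) a := ⟨le_rfl, by linarith⟩
  obtain ⟨hea, hena⟩ := endpoints_ne_of_coreEnergy_lt hs hs₀ h
  obtain ⟨k, hk, hka⟩ := exists_kink_eq (lt_of_le_of_ne (hθ.2.2 a hma).1 hea.symm)
    (hθ.2.2 a hma).2 a
  obtain ⟨l, hl, hla⟩ := exists_kink_eq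
    (neg_lt_neg (lt_of_le_of_ne (hθ.2.2 (-a) hmna).2 hena))
    (neg_le.1 (hθ.2.2 (-a) hmna).1) a
  set L := reflect (kink l) with hL
  have hLa : L (-a) = θ (-a) := by rw [hL, reflect, neg_neg, hla, neg_neg]
  have hLac : LocallyAC L := by
    have := (locallyAC_kink l).comp_neg.const_mul (-1)
    simp only [neg_one_mul] at this
    exact this
  set M := glue (-a) L θ with hM
  have hMac : LocallyAC M := hLac.glue hθ.1 hLa
  have hMa : M a = kink k a := by rw [hM, glue_of_lt _ _ (by linarith), hka]
  set η := glue a M (kink k) with hη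
  have hηac : LocallyAC η := hMac.glue (locallyAC_kink k) hMa
  have hηL : ∀ x, x < -a → η x = L x := fun x hx => by
    rw [hη, glue_of_le _ _ (by linarith), hM, glue_of_le _ _ hx.le]
  have hηR : ∀ x, a < x → η x = kink k x := fun x hx => by rw [hη, glue_of_lt _ _ hx]
  have hηM : ∀ x, -a < x → x ≤ a → η x = θ x := fun x hx hx' => by
    rw [hη, glue_of_le _ _ hx', hM, glue_of_lt _ _ hx]
  have hdL : ∀ x, x < -a → deriv η x = Real.cos (L x) := fun x hx => by
    rw [hη, deriv_glue_of_lt _ _ (by linarith), hM, deriv_glue_of_lt _ _ hx,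
      deriv_reflect_kink]
  have hdR : ∀ x, a < x → deriv η x = Real.cos (kink k x) := fun x hx => by
    rw [hη, deriv_glue_of_gt _ _ hx, deriv_kink]
  have hdM : ∀ x, -a < x → x < a → deriv η x = deriv θ x := fun x hx hx' => by
    rw [hη, deriv_glue_of_lt _ _ hx', hM, deriv_glue_of_gt _ _ hx]
  have hmem : ∀ f : ℝ → ℝ, MemLp f 2 (volume.restrict (Set.Iio (-a))) →
      MemLp f 2 (volume.restrict (Set.Ioo (-a) a)) →
      MemLp f 2 (volume.restrict (Set.Ioi a)) → MemLp f 2 volume := by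
    intro f h1 h2 h3
    rw [restrict_Iio_eq_restrict_Iic] at h1
    rw [restrict_Ioo_eq_restrict_Ioc] at h2
    have h4 : MemLp f 2 (volume.restrict (Set.Iic a)) := by
      rw [← Set.piecewise_same (Set.Iic (-a)) f]
      refine MemLp.piecewise measurableSet_Iic ?_ ?_
      · rwa [Measure.restrict_restrict measurableSet_Iic, Set.inter_eq_left.2
          (Set.Iic_subset_Iic.2 (by linarith))]
      · rwa [Measure.restrict_restrict measurableSet_Iic.compl, Set.compl_Iic,
          Set.Ioi_inter_Iic]
    rw [← Set.piecewise_same (Set.Iic a) f]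
    exact MemLp.piecewise measurableSet_Iic h4 (by rwa [Set.compl_Iic])
  have hcongr : ∀ {S : Set ℝ} {f g : ℝ → ℝ}, MeasurableSet S → (∀ x ∈ S, f x = g x) →
      MemLp g 2 (volume.restrict S) → MemLp f 2 (volume.restrict S) := by
    intro S f g hS hfg hg
    refine (memLp_congr_ae ?_).2 hg
    filter_upwards [ae_restrict_mem hS] with x hx using hfg x hx
  have hθc : MemLp (fun x => Real.cos (θ x)) 2 (volume.restrict (Set.Ioo (-a) a)) :=
    MemLp.of_bound (Real.continuous_cos.comp hθ.1.continuous).aestronglyMeasurable 1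
      (Eventually.of_forall fun x => Real.abs_cos_le_one _)
  have hθd : MemLp (deriv θ) 2 (volume.restrict (Set.Ioo (-a) a)) := by
    rw [restrict_Ioo_eq_restrict_Ioc]
    exact hθ.2.1
  have m1 : MemLp (deriv η) 2 volume := hmem _
    (hcongr measurableSet_Iio hdL (memLp_cos_reflect_kink l a))
    (hcongr measurableSet_Ioo (fun x hx => hdM x hx.1 hx.2) hθd)
    (hcongr measurableSet_Ioi hdR (memLp_cos_kink k a))
  have m2 : MemLp (fun x => Real.cos (η x)) 2 volume := hmem _
    (hcongr measurableSet_Iio (fun x hx => by rw [hηL x hx]) (memLp_cos_reflect_kink l a))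
    (hcongr measurableSet_Ioo (fun x hx => by rw [hηM x hx.1 hx.2.le]) hθc)
    (hcongr measurableSet_Ioi (fun x hx => by rw [hηR x hx]) (memLp_cos_kink k a))
  have t1 : Tendsto η atBot (𝓝 (-(Real.pi / 2))) := by
    refine (((tendsto_kink l).comp tendsto_neg_atBot_atTop).neg).congr' ?_
    filter_upwards [Iio_mem_atBot (-a)] with x hx
    exact (hηL x hx).symm
  have t2 : Tendsto η atTop (𝓝 (Real.pi / 2)) := by
    refine (tendsto_kink k).congr' ?_
    filter_upwards [Ioi_mem_atTop a] with x hx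
    exact (hηR x hx).symm
  have hr : ∀ x, η x ∈ Set.Icc (-(Real.pi / 2)) (Real.pi / 2) := by
    intro x
    rcases le_or_gt x a with hx | hx
    · rcases le_or_gt x (-a) with hx' | hx'
      · have hm := kink_mem hl (-x)
        rw [hη, glue_of_le _ _ hx, hM, glue_of_le _ _ hx', hL, reflect]
        exact ⟨neg_le_neg hm.2, neg_le.1 hm.1⟩
      · rw [hηM x hx' hx]
        exact hθ.2.2 x ⟨hx'.le, hx⟩
    · rw [hηR x hx]
      exact kink_mem hk x
  have hηl : η ∈ liftings := ⟨hηac, m1, m2⟩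
  refine ⟨η, mem_liftingsW_iff.2 ⟨⟨hηl, t1, 0, by simpa using t2⟩, hr⟩, ?_⟩
  rw [hs.energy_eq_integral hs₀ hηl, integral_eq_add_add (hs.integrable_energyDensity hs₀ hηl)
    ha.le, coreEnergy]
  have e1 : ∫ x in Set.Ioc (-a) a, energyDensity s η x =
      ∫ x in Set.Ioc (-a) a, energyDensity s θ x := by
    rw [integral_Ioc_eq_integral_Ioo, integral_Ioc_eq_integral_Ioo]
    refine setIntegral_congr_fun measurableSet_Ioo fun x hx => ?_
    simp only [energyDensity, hdM x hx.1 hx.2, hηM x hx.1 hx.2.le]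
  have e2 : ∫ x in Set.Iic (-a), energyDensity s η x = 1 + Real.sin (θ (-a)) := by
    have h1 : ∫ x in Set.Iic (-a), energyDensity s η x =
        ∫ x in Set.Iic (-a), (fun y => Real.cos (kink l y) ^ 2) (-x) := by
      rw [integral_Iic_eq_integral_Iio, integral_Iic_eq_integral_Iio]
      refine setIntegral_congr_fun measurableSet_Iio fun x hx => ?_
      simp only [energyDensity, hdL x hx, hηL x hx, hL, reflect, Real.cos_neg,
        hs.eq_one x fun h' => (not_le.2 hx) h'.1]
      ring
    rw [h1, integral_comp_neg_Iic (-a) fun y => Real.cos (kink l y) ^ 2, neg_neg, integral_cos_kink_sq, hla, Real.sin_neg]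
    ring
  have e3 : ∫ x in Set.Ioi a, energyDensity s η x = 1 - Real.sin (θ a) := by
    rw [← hka, ← integral_cos_kink_sq]
    refine setIntegral_congr_fun measurableSet_Ioi fun x hx => ?_
    simp only [energyDensity, hdR x hx, hηR x hx, hs.eq_one x fun h' => (not_le.2 hx) h'.2]
    ring
  rw [e1, e2, e3]

theorem exists_isMinimizer (hs : IsNotch s₀ a s) (hs₀ : 0 < s₀) (ha : 0 < a)
    (hs1 : ∃ x, s x ≠ 1) : ∃ θ, IsMinimizer s liftingsNe θ := by
  obtain ⟨θ, hθ, hmin⟩ := exists_coreEnergy_minimizer hs hs₀ ha.le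
  obtain ⟨ζ, hζ, hlt⟩ := exists_mem_coreClass_lt_two hs ha hs1
  obtain ⟨η, hη, he⟩ := exists_extension hs hs₀ ha hθ ((hmin ζ hζ).trans_lt hlt)
  refine ⟨η, hη.1, fun ξ hξ => ?_⟩
  have hc := clamp_mem_liftingsW hξ
  -- For a competitor `ξ`: the core minimum is at most the core energy of its truncation, then the
  -- full energy of the truncation, then that of `ξ`.
  rw [he]
  exact (hmin _ ⟨hc.1.1.1, hc.1.1.2.1.restrict _, fun x _ => clamp_mem ξ x⟩).trans
    ((coreEnergy_le_energy hs hs₀ ha.le hc).trans (energy_clamp_le hs hs₀ hξ))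

end NotchedWire

theorem proposition2 (s₀ a : ℝ) (hs₀ : 0 < s₀) (s : ℝ → ℝ)
    (hs : NotchedWire.IsUnimodalNotch s₀ a s) (hs1 : ∃ x, s x ≠ 1) :
    -- existence of a minimizer, which solves the Sturm–Liouville equation
    (∃ θ : ℝ → ℝ, NotchedWire.IsMinimizer s NotchedWire.liftingsNe θ ∧
      NotchedWire.IsWeakSolution s θ ∧ NotchedWire.IsStrongSolution s θ) ∧
    -- functions outside `W` are not optimal, and minimizers belong to `W`
    (∀ θ₁ ∈ NotchedWire.liftingsNe \ NotchedWire.liftingsW,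
      ∃ θ₀ ∈ NotchedWire.liftingsW, NotchedWire.energy s θ₀ < NotchedWire.energy s θ₁) ∧
    (∀ θ : ℝ → ℝ, NotchedWire.IsMinimizer s NotchedWire.liftingsNe θ →
      θ ∈ NotchedWire.liftingsW) ∧
    -- minimizers are increasing
    (∀ θ : ℝ → ℝ, NotchedWire.IsMinimizer s NotchedWire.liftingsW θ ∨
      NotchedWire.IsMinimizer s NotchedWire.liftingsNe θ → StrictMono θ) ∧
    -- minimizers are odd if the notch is symmetric
    (NotchedWire.IsSymmetricNotch s₀ a s →
      ∀ θ : ℝ → ℝ, NotchedWire.IsMinimizer s NotchedWire.liftingsW θ ∨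
        NotchedWire.IsMinimizer s NotchedWire.liftingsNe θ → Function.Odd θ) := by
  have hn := hs.toIsNotch
  have hNe : ∀ θ : ℝ → ℝ, NotchedWire.IsMinimizer s NotchedWire.liftingsW θ ∨
      NotchedWire.IsMinimizer s NotchedWire.liftingsNe θ →
      NotchedWire.IsMinimizer s NotchedWire.liftingsNe θ := fun θ h =>
    h.elim (fun h => h.of_liftingsW hn hs₀) id
  refine ⟨?_, ?_, fun θ h => h.mem_liftingsW hn hs₀, fun θ h => ?_, fun hsym θ h =>
    (hNe θ h).odd hs hsym hs₀ hs1⟩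
  · obtain ⟨θ, hθ⟩ := NotchedWire.exists_isMinimizer hn hs₀ (hs.pos_of_ne_one hs1) hs1
    obtain ⟨p, hp⟩ := hθ.exists_isExtremal hn hs₀
    exact ⟨θ, hθ, hθ.isWeakSolution hn hs₀, hp.isStrongSolution hn hs₀⟩
  · rintro θ ⟨hθ, hW⟩
    exact ⟨NotchedWire.clamp θ, NotchedWire.clamp_mem_liftingsW hθ,
      NotchedWire.energy_clamp_lt hn hs₀ hθ hW⟩
  · obtain ⟨p, hp⟩ := (hNe θ h).exists_isExtremal hn hs₀
    exact hp.strictMono hs hs₀ ((hNe θ h).mem_liftingsW hn hs₀)
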